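/- Let $\Omega\subset\mathbb{R}^2$ be a bounded domain with boundary of class $C^{0,1}$, let $\Gamma_D,\Gamma_N$ be disjoint relatively open subsets of $\partial\Omega$ with $\Gamma_D\neq\emptyset$ and $\partial\Omega\setminus(\Gamma_D\cup\Gamma_N)$ finite, and let $0<T<\infty$. Let $\mathcal{E}(\overline\Omega)$ be the set of $u\in C^\infty(\overline\Omega)^2$ with $\operatorname{div}u=0$ in $\Omega$ and $\operatorname{supp}u\cap\overline{\Gamma_D}=\emptyset$ (where $C^\infty(\overline\Omega)$ consists of the restrictions of smooth functions on $\mathbb{R}^2$). Let $V_\kappa$ and $L^2_\kappa$ be the closures of $\mathcal{E}(\overline\Omega)$ in $W^{1,2}(\Omega)^2$ and in $L^2(\Omega)^2$, respectively. Write $(\cdot,\cdot)$ for the scalar product of $L^2(\Omega)^2$, $((v,w))=\int_\Omega\nabla v\cdot\nabla w\,dx$, and $$b(\theta,\psi,\varphi)=\int_\Omega\sum_{i,j=1}^2\theta_j\,\frac{\partial\psi_i}{\partial x_j}\,\varphi_i\,dx\qquad(\theta,\psi,\varphi\in V_\kappa).$$ Let $\mathcal{D}$ be the space of all $w\in V_\kappa$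 for which there is $f\in L^2_\kappa$ with $((w,v))=(f,v)$ for all $v\in V_\kappa$, normed by $\|w\|_{\mathcal{D}}=\|f\|_{L^2(\Omega)^2}$. Put $$X=\{u\in L^2(0,T;\mathcal{D}):\ u'\in L^2(0,T;L^2_\kappa)\},\qquad Y=L^2(0,T;L^2_\kappa)\times V_\kappa,$$ where $u'$ is the distributional derivative in time. For $u\in X$ let $u(0)$ denote the value at $0$ of the continuous representative of $u$ on $[0,T]$, and let $$\mathcal{N}(u)=\bigl[\,(u'(t),\cdot)+((u(t),\cdot))+b(u(t),u(t),\cdot)\,;\ u(0)\,\bigr].$$ Here the first component is regarded as a functional on $V_\kappa$ for almost every $t\in(0,T)$, and two such components are equal if the functionals coincide for almost every $t$. An element $[g;\omega]\in Y$ is identified with $[(g(t),\cdot);\omega]$. Then $\mathcal{N}$ is injective on $X$: if $u_1,u_2\in X$ and $\mathcal{N}(u_1)=\mathcal{N}(u_2)$, then $u_1=u_2$. Consequently, for given data $[f;u_0]\in Y$ there is at most one $u\in X$ that is a generalized solution of the Navier--Stokes problem (with viscosity $1$) with mixed boundary conditions, that is, at most one $u\in X$ such that $u(0)=u_0$ and,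 for almost every $t\in(0,T)$, $$(u'(t),v)+((u(t),v))+b(u(t),u(t),v)=(f(t),v)\qquad\text{for all }v\in V_\kappa.$$ -/

import Mathlib

open MeasureTheory Filter Topology Set
open scoped ContDiff NNReal ENNReal

noncomputable section

namespace MixedNS

/-- The plane with its Euclidean norm; also the space of values of velocity fields. -/
abbrev Plane : Type := EuclideanSpace ℝ (Fin 2)

/-- Real `2 × 2` matrices with the Frobenius norm; the entry `(i, j)` of a velocity gradient is
`∂ u_i / ∂ x_j`. -/
abbrev Mat : Type := EuclideanSpace ℝ (Fin 2 × Fin 2)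

/-- The `j`-th standard unit vector. -/
abbrev unitVec (j : Fin 2) : Plane := EuclideanSpace.single j (1 : ℝ)

/-! ### The domain -/

/-- Boundary of class `C^{0,1}`: near each boundary point, in suitable Cartesian coordinates,
`Ω` is the part of the plane strictly below the graph of a Lipschitz function. -/
def HasLipschitzBoundary (Ω : Set Plane) : Prop :=
  ∀ x ∈ frontier Ω, ∃ (e : Plane ≃ᵃⁱ[ℝ] Plane) (g : ℝ → ℝ) (K : ℝ≥0) (r : ℝ),
    0 < r ∧ LipschitzWith K g ∧ ∀ y ∈ Metric.ball x r, y ∈ Ω ↔ e y 1 < g (e y 0)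

/-- A bounded planar Lipschitz domain `Ω` whose boundary consists of two disjoint relatively open
parts `ΓD` (nonempty) and `ΓN`, up to finitely many points. -/
structure IsMixedDomain (Ω ΓD ΓN : Set Plane) : Prop where
  isOpen : IsOpen Ω
  isConnected : IsConnected Ω
  isBounded : Bornology.IsBounded Ω
  lipschitz : HasLipschitzBoundary Ω
  dirichlet_open : ∃ U : Set Plane, IsOpen U ∧ ΓD = U ∩ frontier Ω
  neumann_open : ∃ U : Set Plane, IsOpen U ∧ ΓN = U ∩ frontier Ω
  disjoint : Disjoint ΓD ΓN
  dirichlet_nonempty : ΓD.Nonempty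
  finite_rest : (frontier Ω \ (ΓD ∪ ΓN)).Finite

/-! ### Function spaces on `Ω` -/

/-- `L²(Ω)²`. -/
abbrev L2Vec (Ω : Set Plane) : Type := Lp Plane 2 (volume.restrict Ω)

/-- `L²(Ω)` with values in the `2 × 2` matrices. -/
abbrev L2Mat (Ω : Set Plane) : Type := Lp Mat 2 (volume.restrict Ω)

/-- `G` is the weak (distributional) gradient of `u` in `Ω`. -/
def HasWeakGrad (Ω : Set Plane) (u : L2Vec Ω) (G : L2Mat Ω) : Prop :=
  ∀ φ : Plane → ℝ, ContDiff ℝ ∞ φ → HasCompactSupport φ → tsupport φ ⊆ Ω → ∀ i j : Fin 2,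
    ∫ x in Ω, u x i * fderiv ℝ φ x (unitVec j) = - ∫ x in Ω, G x (i, j) * φ x

/-- Products of a coordinate of an `L²` function with a continuous compactly supported function
are integrable. -/
theorem integrable_coord_mul {ι : Type} [Fintype ι] {Ω : Set Plane}
    (u : Lp (EuclideanSpace ℝ ι) 2 (volume.restrict Ω)) (i : ι) {φ : Plane → ℝ}
    (hc : Continuous φ) (hs : HasCompactSupport φ) :
    Integrable (fun x => u x i * φ x) (volume.restrict Ω) := by
  have h1 : MemLp (fun x => u x i) 2 (volume.restrict Ω) :=
    (EuclideanSpace.proj (𝕜 := ℝ) i).comp_memLp' (Lp.memLp u)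
  have h2 : MemLp φ 2 (volume.restrict Ω) := hc.memLp_of_hasCompactSupport hs
  exact h1.integrable_mul h2

theorem continuous_partial {φ : Plane → ℝ} (h : ContDiff ℝ ∞ φ) (j : Fin 2) :
    Continuous (fun x => fderiv ℝ φ x (unitVec j)) :=
  (h.continuous_fderiv (by simp)).clm_apply continuous_const

theorem hasCompactSupport_partial {φ : Plane → ℝ} (h : HasCompactSupport φ) (j : Fin 2) :
    HasCompactSupport (fun x => fderiv ℝ φ x (unitVec j)) :=
  h.fderiv_apply ℝ (unitVec j)

/-- The Sobolev space `W^{1,2}(Ω)²`: the pairs `(u, ∇u)` of an `L²` field and its weak gradient,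
with the inner product `(u, v) + (∇u, ∇v)`. -/
def W12 (Ω : Set Plane) : Submodule ℝ (WithLp 2 (L2Vec Ω × L2Mat Ω)) where
  carrier := {w | HasWeakGrad Ω w.fst w.snd}
  zero_mem' := by
    intro φ _ _ _ i j
    have h1 : ∀ᵐ x ∂(volume.restrict Ω), ((0 : L2Vec Ω) x) = 0 := Lp.coeFn_zero ..
    have h2 : ∀ᵐ x ∂(volume.restrict Ω), ((0 : L2Mat Ω) x) = 0 := Lp.coeFn_zero ..
    have e1 : ∫ x in Ω, ((0 : L2Vec Ω) x) i * fderiv ℝ φ x (unitVec j) = 0 :=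
      integral_eq_zero_of_ae (by filter_upwards [h1] with x hx; rw [hx]; simp)
    have e2 : ∫ x in Ω, ((0 : L2Mat Ω) x) (i, j) * φ x = 0 :=
      integral_eq_zero_of_ae (by filter_upwards [h2] with x hx; rw [hx]; simp)
    simp only [WithLp.zero_fst, WithLp.zero_snd]
    rw [e1, e2, neg_zero]
  add_mem' := by
    intro a b ha hb φ h1 h2 h3 i j
    have ha := ha φ h1 h2 h3 i j
    have hb := hb φ h1 h2 h3 i j
    have e1 : ∫ x in Ω, ((a + b).fst x) i * fderiv ℝ φ x (unitVec j)
        = ∫ x in Ω, (a.fst x i * fderiv ℝ φ x (unitVec j)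
            + b.fst x i * fderiv ℝ φ x (unitVec j)) :=
      integral_congr_ae (by
        filter_upwards [Lp.coeFn_add a.fst b.fst] with x hx
        rw [WithLp.add_fst, hx, Pi.add_apply, PiLp.add_apply, add_mul])
    have e2 : ∫ x in Ω, ((a + b).snd x) (i, j) * φ x
        = ∫ x in Ω, (a.snd x (i, j) * φ x + b.snd x (i, j) * φ x) :=
      integral_congr_ae (by
        filter_upwards [Lp.coeFn_add a.snd b.snd] with x hx
        rw [WithLp.add_snd, hx, Pi.add_apply, PiLp.add_apply, add_mul])
    have c := continuous_partial h1 j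
    have s := hasCompactSupport_partial h2 j
    rw [e1, e2, integral_add (integrable_coord_mul _ _ c s) (integrable_coord_mul _ _ c s),
      integral_add (integrable_coord_mul _ _ h1.continuous h2)
        (integrable_coord_mul _ _ h1.continuous h2), ha, hb, neg_add]
  smul_mem' := by
    intro r a ha φ h1 h2 h3 i j
    have ha := ha φ h1 h2 h3 i j
    have e1 : ∫ x in Ω, ((r • a).fst x) i * fderiv ℝ φ x (unitVec j)
        = ∫ x in Ω, r * (a.fst x i * fderiv ℝ φ x (unitVec j)) :=
      integral_congr_ae (by
        filter_upwards [Lp.coeFn_smul r a.fst] with x hx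
        rw [WithLp.smul_fst, hx, Pi.smul_apply, PiLp.smul_apply, smul_eq_mul, mul_assoc])
    have e2 : ∫ x in Ω, ((r • a).snd x) (i, j) * φ x
        = ∫ x in Ω, r * (a.snd x (i, j) * φ x) :=
      integral_congr_ae (by
        filter_upwards [Lp.coeFn_smul r a.snd] with x hx
        rw [WithLp.smul_snd, hx, Pi.smul_apply, PiLp.smul_apply, smul_eq_mul, mul_assoc])
    rw [e1, e2, integral_const_mul, integral_const_mul, ha, mul_neg]

/-- Pairing with a fixed continuous compactly supported function is continuous on `L²`. -/
theorem continuous_integral_coord_mul {ι : Type} [Fintype ι] [DecidableEq ι] (Ω : Set Plane)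
    (i : ι) {φ : Plane → ℝ} (hc : Continuous φ) (hs : HasCompactSupport φ) :
    Continuous (fun u : Lp (EuclideanSpace ℝ ι) 2 (volume.restrict Ω) =>
      ∫ x in Ω, u x i * φ x) := by
  have h : MemLp (fun x => φ x • EuclideanSpace.single i (1 : ℝ)) 2 (volume.restrict Ω) :=
    (hc.smul continuous_const).memLp_of_hasCompactSupport hs.smul_right
  have e : ∀ u : Lp (EuclideanSpace ℝ ι) 2 (volume.restrict Ω),
      ∫ x in Ω, u x i * φ x = inner ℝ (h.toLp _) u := by
    intro u
    rw [L2.inner_def]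
    refine integral_congr_ae ?_
    filter_upwards [h.coeFn_toLp] with x hx
    rw [hx, real_inner_smul_left, EuclideanSpace.inner_single_left]
    simp [mul_comm]
  simp_rw [e]
  exact continuous_const.inner continuous_id

/-- `W^{1,2}(Ω)²` is a complete subspace. -/
theorem isClosed_W12 (Ω : Set Plane) :
    IsClosed (W12 Ω : Set (WithLp 2 (L2Vec Ω × L2Mat Ω))) := by
  have e : (W12 Ω : Set (WithLp 2 (L2Vec Ω × L2Mat Ω))) = {w | HasWeakGrad Ω w.fst w.snd} := rfl
  rw [e]
  simp only [HasWeakGrad, Set.ofPred_forall]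
  refine isClosed_iInter fun φ => isClosed_iInter fun h1 => isClosed_iInter fun h2 =>
    isClosed_iInter fun _ => isClosed_iInter fun i => isClosed_iInter fun j => ?_
  exact isClosed_eq
    ((continuous_integral_coord_mul Ω i (continuous_partial h1 j)
      (hasCompactSupport_partial h2 j)).comp (WithLp.fstL 2 ℝ (L2Vec Ω) (L2Mat Ω)).continuous)
    ((continuous_integral_coord_mul Ω (i, j) h1.continuous h2).comp
      (WithLp.sndL 2 ℝ (L2Vec Ω) (L2Mat Ω)).continuous).neg

/-- The space `ℰ(Ω̄)` of smooth solenoidal fields on `Ω̄` whose support does not meet the closure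
of `ΓD`. Functions in `C^∞(Ω̄)` are the restrictions of smooth functions on the plane, and such a
field is represented by a smooth function on the plane. -/
def smoothFields (Ω ΓD : Set Plane) : Submodule ℝ (Plane → Plane) where
  carrier := {φ | ContDiff ℝ ∞ φ ∧ (∀ x ∈ Ω, ∑ i, fderiv ℝ φ x (unitVec i) i = 0) ∧
    Disjoint (closure (Function.support φ ∩ closure Ω)) (closure ΓD)}
  zero_mem' := by
    refine ⟨contDiff_const, fun x _ => ?_, by simp⟩
    simp
  add_mem' := by
    rintro a b ⟨ha1, ha2, ha3⟩ ⟨hb1, hb2, hb3⟩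
    refine ⟨ha1.add hb1, fun x hx => ?_, ?_⟩
    · have da : DifferentiableAt ℝ a x := ha1.differentiable (by simp) x
      have db : DifferentiableAt ℝ b x := hb1.differentiable (by simp) x
      rw [fderiv_add da db]
      simp only [add_apply, PiLp.add_apply, Finset.sum_add_distrib]
      rw [ha2 x hx, hb2 x hx, add_zero]
    · refine Disjoint.mono_left ?_ (ha3.union_left hb3)
      rw [← closure_union]
      refine closure_mono ?_
      rw [← union_inter_distrib_right]
      exact inter_subset_inter_left _ (Function.support_add a b)
  smul_mem' := by
    rintro r a ⟨ha1, ha2, ha3⟩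
    refine ⟨contDiff_const.smul ha1, fun x hx => ?_, ?_⟩
    · have da : DifferentiableAt ℝ a x := ha1.differentiable (by simp) x
      rw [fderiv_const_smul da]
      simp only [smul_apply, PiLp.smul_apply, smul_eq_mul, ← Finset.mul_sum]
      rw [ha2 x hx, mul_zero]
    · refine Disjoint.mono_left (closure_mono (inter_subset_inter_left _ ?_)) ha3
      exact Function.support_const_smul_subset r a

/-- The fields of `ℰ(Ω̄)`, as elements of `L²(Ω)²`. -/
def smoothL2 (Ω ΓD : Set Plane) : Submodule ℝ (L2Vec Ω) where
  carrier := {u | ∃ φ ∈ smoothFields Ω ΓD, u =ᵐ[volume.restrict Ω] φ}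
  zero_mem' := ⟨0, zero_mem _, Lp.coeFn_zero ..⟩
  add_mem' := by
    rintro a b ⟨φ, hφ, ha⟩ ⟨ψ, hψ, hb⟩
    exact ⟨φ + ψ, add_mem hφ hψ, (Lp.coeFn_add a b).trans (ha.add hb)⟩
  smul_mem' := by
    rintro r a ⟨φ, hφ, ha⟩
    exact ⟨r • φ, Submodule.smul_mem _ r hφ, (Lp.coeFn_smul r a).trans (ha.const_smul r)⟩

/-- The space `L²_κ`: the closure of `ℰ(Ω̄)` in `L²(Ω)²`, with the inner product of `L²(Ω)²`. -/
abbrev Lκ (Ω ΓD : Set Plane) : Submodule ℝ (L2Vec Ω) := (smoothL2 Ω ΓD).topologicalClosure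

/-- The fields of `ℰ(Ω̄)` with their gradients, as elements of `W^{1,2}(Ω)²`. -/
def smoothW12 (Ω ΓD : Set Plane) : Submodule ℝ (WithLp 2 (L2Vec Ω × L2Mat Ω)) :=
  W12 Ω ⊓ (smoothL2 Ω ΓD).comap (WithLp.fstL 2 ℝ (L2Vec Ω) (L2Mat Ω)).toLinearMap

/-- The space `V_κ`: the closure of `ℰ(Ω̄)` in the norm of `W^{1,2}(Ω)²`. -/
abbrev Vκ (Ω ΓD : Set Plane) : Submodule ℝ (WithLp 2 (L2Vec Ω × L2Mat Ω)) :=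
  (smoothW12 Ω ΓD).topologicalClosure

theorem Vκ_le_W12 (Ω ΓD : Set Plane) : Vκ Ω ΓD ≤ W12 Ω :=
  Submodule.topologicalClosure_minimal _ inf_le_left (isClosed_W12 Ω)

section Spaces

variable {Ω ΓD : Set Plane}

theorem fst_mem_Lκ (v : Vκ Ω ΓD) : WithLp.fstL 2 ℝ (L2Vec Ω) (L2Mat Ω) v.1 ∈ Lκ Ω ΓD :=
  map_mem_closure (WithLp.fstL 2 ℝ (L2Vec Ω) (L2Mat Ω)).continuous v.2 (fun _ hw => hw.2)

/-- The inclusion `V_κ ⊆ L²_κ`. -/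
def toLκ : Vκ Ω ΓD →L[ℝ] Lκ Ω ΓD :=
  ((WithLp.fstL 2 ℝ (L2Vec Ω) (L2Mat Ω)).comp (Vκ Ω ΓD).subtypeL).codRestrict
    (Lκ Ω ΓD) fst_mem_Lκ

/-- The velocity field of an element of `V_κ`. -/
def field (v : Vκ Ω ΓD) : L2Vec Ω := v.1.fst

/-- The weak gradient of an element of `V_κ`. -/
def grad (v : Vκ Ω ΓD) : L2Mat Ω := v.1.snd

/-- The form `((v, w)) = ∫_Ω ∇v · ∇w`. -/
def energy (v w : Vκ Ω ΓD) : ℝ := inner ℝ (grad v) (grad w)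

/-- The form `b(θ, ψ, φ) = ∫_Ω θ_j (∂ψ_i / ∂x_j) φ_i`, summed over `i` and `j`. -/
def trilinear (θ ψ φ : Vκ Ω ΓD) : ℝ :=
  ∫ x in Ω, ∑ i : Fin 2, ∑ j : Fin 2, field θ x j * grad ψ x (i, j) * field φ x i

/-- `f ∈ L²_κ` corresponds to `w ∈ V_κ`: `((w, v)) = (f, v)` for all `v ∈ V_κ`. -/
def Corresponds (w : Vκ Ω ΓD) (f : Lκ Ω ΓD) : Prop :=
  ∀ v : Vκ Ω ΓD, energy w v = inner ℝ f (toLκ v)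

/-- The space `𝒟` of all `w ∈ V_κ` with a corresponding `f ∈ L²_κ`; its norm is
`‖w‖_𝒟 = ‖f‖`. -/
def 𝒟 (Ω ΓD : Set Plane) : Set (Vκ Ω ΓD) := {w | ∃ f : Lκ Ω ΓD, Corresponds w f}

end Spaces

/-! ### Spaces of time-dependent functions -/

/-- The Bochner space `L²(0,T;E)`. -/
abbrev TimeL2 (T : ℝ) (E : Type) [NormedAddCommGroup E] : Type :=
  Lp E 2 (volume.restrict (Ioo (0 : ℝ) T))

/-- `g` is the weak (distributional) derivative of `u` on the interval `(0,T)`. -/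
def IsTimeDeriv {E : Type} [NormedAddCommGroup E] [NormedSpace ℝ E] (T : ℝ) (u g : ℝ → E) :
    Prop :=
  ∀ η : ℝ → ℝ, ContDiff ℝ ∞ η → HasCompactSupport η → tsupport η ⊆ Ioo 0 T →
    ∫ t in Ioo 0 T, deriv η t • u t = - ∫ t in Ioo 0 T, η t • g t

section Evolution

variable {Ω ΓD : Set Plane} {T : ℝ}

/-- `u ∈ L²(0,T;𝒟)`. By definition of its norm, `𝒟` is carried isometrically to `L²_κ` by
`w ↦ f`, so this says that `u(t) ∈ 𝒟` for almost every `t` and that the corresponding functions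
`f(t)` form an element of `L²(0,T;L²_κ)`. -/
def MemL2𝒟 (u : TimeL2 T (Vκ Ω ΓD)) : Prop :=
  ∃ f : TimeL2 T (Lκ Ω ΓD), ∀ᵐ t ∂(volume.restrict (Ioo (0 : ℝ) T)), Corresponds (u t) (f t)

/-- The space `X` of all `u ∈ L²(0,T;𝒟)` with `u' ∈ L²(0,T;L²_κ)`. -/
def X (Ω ΓD : Set Plane) (T : ℝ) : Set (TimeL2 T (Vκ Ω ΓD)) :=
  {u | MemL2𝒟 u ∧ ∃ g : TimeL2 T (Lκ Ω ΓD), IsTimeDeriv T (fun t => toLκ (u t)) g}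

/-- The derivative `u' ∈ L²(0,T;L²_κ)` of `u ∈ X`. -/
def timeDeriv (u : X Ω ΓD T) : TimeL2 T (Lκ Ω ΓD) := u.2.2.choose

open Classical in
/-- The initial value `u(0)`: the value at `0` of the continuous representative of `u` on `[0,T]`.
The representative is taken with values in `L²_κ`, which contains `V_κ`. -/
def initialValue (u : X Ω ΓD T) : Lκ Ω ΓD :=
  if h : ∃ c : ℝ → Lκ Ω ΓD, ContinuousOn c (Icc 0 T) ∧
      (fun t => toLκ (u.1 t)) =ᵐ[volume.restrict (Ioo (0 : ℝ) T)] c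
  then h.choose 0 else 0

/-- The space of data `Y = L²(0,T;L²_κ) × V_κ`. -/
abbrev Y (Ω ΓD : Set Plane) (T : ℝ) : Type := TimeL2 T (Lκ Ω ΓD) × Vκ Ω ΓD

/-- Pairs of a time-dependent functional on `V_κ`, up to equality for almost every `t ∈ (0,T)`, and
an initial velocity. -/
abbrev FunctionalData (Ω ΓD : Set Plane) (T : ℝ) : Type :=
  Germ (ae (volume.restrict (Ioo (0 : ℝ) T))) (Vκ Ω ΓD → ℝ) × Lκ Ω ΓD

/-- The identification of `[g; ω] ∈ Y` with the functionals `v ↦ (g(t), v)` and `ω ∈ L²_κ`. -/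
def Y.toFunctionalData (y : Y Ω ΓD T) : FunctionalData Ω ΓD T :=
  (((fun t v => inner ℝ (y.1 t) (toLκ v)) : ℝ → Vκ Ω ΓD → ℝ), toLκ y.2)

/-- The Navier–Stokes operator
`𝒩(u) = [(u'(t), ·) + ((u(t), ·)) + b(u(t), u(t), ·); u(0)]`. -/
def 𝒩 (u : X Ω ΓD T) : FunctionalData Ω ΓD T :=
  (((fun t v => inner ℝ (timeDeriv u t) (toLκ v) + energy (u.1 t) v
    + trilinear (u.1 t) (u.1 t) v) : ℝ → Vκ Ω ΓD → ℝ), initialValue u)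

/-- `u ∈ X` is a generalized solution of the Navier–Stokes problem with mixed boundary conditions
for the data `[f; u₀] ∈ Y`. -/
def IsGeneralizedSolution (u : X Ω ΓD T) (f : TimeL2 T (Lκ Ω ΓD)) (u₀ : Vκ Ω ΓD) : Prop :=
  (∀ᵐ t ∂(volume.restrict (Ioo (0 : ℝ) T)), ∀ v : Vκ Ω ΓD,
    inner ℝ (timeDeriv u t) (toLκ v) + energy (u.1 t) v + trilinear (u.1 t) (u.1 t) v
      = inner ℝ (f t) (toLκ v)) ∧
  initialValue u = toLκ u₀

/-- The generalized formulation is the operator equation `𝒩(u) = [f; u₀]`. -/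
theorem isGeneralizedSolution_iff (u : X Ω ΓD T) (f : TimeL2 T (Lκ Ω ΓD)) (u₀ : Vκ Ω ΓD) :
    IsGeneralizedSolution u f u₀ ↔ 𝒩 u = Y.toFunctionalData (f, u₀) := by
  unfold IsGeneralizedSolution 𝒩 Y.toFunctionalData
  rw [Prod.mk.injEq, Germ.coe_eq]
  refine and_congr_left fun _ => eventually_congr (Eventually.of_forall fun t => ?_)
  exact funext_iff.symm

end Evolution

end MixedNS

end

open MeasureTheory Filter Topology Set
open scoped ContDiff NNReal ENNReal

noncomputable section

namespace MixedNS

/-! Put `w = u₁ - u₂`. Subtracting the two equations and testing at almost every time with `w(t)`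
itself gives `(w', w) + ‖∇w‖² + b(w, u₁, w) + b(u₂, w, w) = 0`. With mixed boundary conditions fluid
may cross the Neumann part, so `b(u₂, w, w)` need not vanish and both convective terms have to be
estimated.

Hölder's inequality bounds them by `‖w‖₄² ‖∇u₁‖` and `‖u₂‖₄ ‖∇w‖ ‖w‖₄`. The two-dimensional
Ladyzhenskaya inequality `‖v‖₄² ≤ C ‖v‖_{L²} ‖v‖_{W^{1,2}}` (`exists_isLadyzhenskayaConst`) and
Young's inequality (`young_estimate`) absorb three quarters of `‖w‖²_{W^{1,2}}`. What remains is `2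
(w', w) + ‖w‖²_{W^{1,2}} / 2 ≤ a(t) ‖w‖²_{L²}`, where `a` is integrable because `u₁, u₂` are square
integrable in time with values in `V_κ` and `u₂` is bounded in time with values in `L²`. Gronwall's
lemma (`eq_zero_of_le_integral_mul`) makes `w` vanish in `L²_κ`. The leftover term on the left then
makes it vanish in `V_κ` too, so the injectivity of `V_κ → L²_κ` is not needed separately.

Two ingredients make this rigorous. In time, a function with an integrable weak derivative is almost
everywhere the primitive of that derivative (`IsTimeDeriv.exists_eq_add_integral`, by du
Bois-Reymond), and the squared norm of such a primitive obeys the chain rule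
(`norm_sq_integral_eq`). In space, the Ladyzhenskaya inequality is proved without an extension
operator: near each point of the closure of a Lipschitz domain there are two independent directions
along which short segments stay inside the domain, and the Gagliardo-Nirenberg argument is run along
those directions. The inequality passes from smooth fields to `V_κ` by Fatou's lemma. -/

theorem intervalIntegrable_of_integrableOn_Ioo {E : Type*} [NormedAddCommGroup E]
    {g : ℝ → E} {T : ℝ} (hT : 0 ≤ T)
    (hg : IntegrableOn g (Ioo 0 T)) : IntervalIntegrable g volume 0 T := by
  rw [intervalIntegrable_iff_integrableOn_Ioo_of_le hT]; exact hg

/-! ### Absolutely continuous functions and weak derivatives in time -/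

section TimeCalculus

variable {E : Type*} [NormedAddCommGroup E] [NormedSpace ℝ E]

/-- The increments of `g` dominate those of `f`, so the same `δ` works. This reduces vector-valued
primitives, and later squared norms, to functions already known to be absolutely continuous. -/
theorem absolutelyContinuousOnInterval_of_dist_le {X Y : Type*} [PseudoMetricSpace X]
    [PseudoMetricSpace Y] {f : ℝ → X} {g : ℝ → Y} {a b : ℝ}
    (hg : AbsolutelyContinuousOnInterval g a b)
    (h : ∀ x ∈ uIcc a b, ∀ y ∈ uIcc a b, dist (f x) (f y) ≤ dist (g x) (g y)) :
    AbsolutelyContinuousOnInterval f a b := by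
  rw [absolutelyContinuousOnInterval_iff] at hg ⊢
  intro ε hε
  obtain ⟨δ, hδ, H⟩ := hg ε hε
  refine ⟨δ, hδ, fun I hI hl => lt_of_le_of_lt (Finset.sum_le_sum fun i hi => ?_) (H I hI hl)⟩
  have := hI.1 i hi
  exact h _ this.1 _ this.2

theorem absolutelyContinuousOnInterval_integral {g : ℝ → E} {T : ℝ}
    (hg : IntervalIntegrable g volume 0 T) :
    AbsolutelyContinuousOnInterval (fun t => ∫ s in (0 : ℝ)..t, g s) 0 T := by
  refine absolutelyContinuousOnInterval_of_dist_le
    (hg.norm.absolutelyContinuousOnInterval_intervalIntegral left_mem_uIcc) fun x hx y hy => ?_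
  have i : ∀ z ∈ uIcc 0 T, IntervalIntegrable g volume 0 z := fun z hz =>
    hg.mono_set (uIcc_subset_uIcc left_mem_uIcc hz)
  rw [dist_eq_norm, Real.dist_eq, intervalIntegral.integral_interval_sub_left (i x hx) (i y hy),
    intervalIntegral.integral_interval_sub_left (i x hx).norm (i y hy).norm]
  exact intervalIntegral.norm_integral_le_abs_integral_norm

/-- Two absolutely continuous functions with the same derivative almost everywhere. -/
theorem sub_eq_of_ae_hasDerivAt {f g f' : ℝ → E} {T : ℝ} (hT : 0 ≤ T)
    (hf : AbsolutelyContinuousOnInterval f 0 T) (hg : AbsolutelyContinuousOnInterval g 0 T)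
    (hf' : ∀ᵐ t, t ∈ uIcc 0 T → HasDerivAt f (f' t) t)
    (hg' : ∀ᵐ t, t ∈ uIcc 0 T → HasDerivAt g (f' t) t) :
    ∀ t ∈ Icc 0 T, f t - g t = f 0 - g 0 := by
  obtain ⟨C, hC⟩ := (hf.sub hg).const_of_ae_hasDerivAt_zero (by
    filter_upwards [hf', hg'] with t h1 h2 ht
    simpa using (h1 ht).sub (h2 ht))
  rw [uIcc_of_le hT] at hC
  intro t ht
  have h1 := hC t ht
  have h0 := hC 0 ⟨le_rfl, hT⟩
  simp only [Pi.sub_apply] at h1 h0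
  rw [h1, h0]

variable [CompleteSpace E]

/-- Integration by parts: `η` times the primitive is absolutely continuous, hence equals the
primitive of its almost everywhere derivative. Evaluation at `T`, where `η` vanishes as it does at
`0`, gives the identity. -/
theorem integral_deriv_smul_integral {g : ℝ → E} {T : ℝ} (hT : 0 ≤ T)
    (hg : IntegrableOn g (Ioo 0 T)) {η : ℝ → ℝ} (hη : ContDiff ℝ ∞ η)
    (hs : tsupport η ⊆ Ioo 0 T) :
    ∫ t in Ioo 0 T, deriv η t • (∫ s in (0 : ℝ)..t, g s) = - ∫ t in Ioo 0 T, η t • g t := by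
  have hi := intervalIntegrable_of_integrableOn_Ioo hT hg
  have hG := absolutelyContinuousOnInterval_integral hi
  have hη1 : ContDiff ℝ 1 η := hη.of_le (by simp)
  have i1 : IntervalIntegrable (fun t => deriv η t • ∫ s in (0 : ℝ)..t, g s) volume 0 T :=
    ((hη1.continuous_deriv le_rfl).continuousOn.smul hG.continuousOn).intervalIntegrable
  have i2 : IntervalIntegrable (fun t => η t • g t) volume 0 T :=
    hi.continuousOn_smul hη.continuous.continuousOn
  have key := sub_eq_of_ae_hasDerivAt hT
    (hη1.contDiffOn.absolutelyContinuousOnInterval.smul hG)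
    (absolutelyContinuousOnInterval_integral (i1.add i2))
    (f' := fun t => deriv η t • (∫ s in (0 : ℝ)..t, g s) + η t • g t) (by
      filter_upwards [hi.ae_hasDerivAt_integral] with t h ht
      have := ((hη1.differentiable (by simp)) t).hasDerivAt.smul (h ht 0 left_mem_uIcc)
      rw [add_comm]; exact this) (by
      filter_upwards [(i1.add i2).ae_hasDerivAt_integral] with t h ht
      exact h ht 0 left_mem_uIcc) T ⟨hT, le_rfl⟩
  have z : ∀ t, t ∉ Ioo 0 T → η t = 0 := fun t ht =>
    image_eq_zero_of_notMem_tsupport fun h => ht (hs h)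
  have z0 := z 0 (by simp)
  have zT := z T (by simp)
  simp only [Pi.smul_apply', z0, zT, zero_smul, intervalIntegral.integral_same, sub_zero, zero_sub,
    neg_eq_zero] at key
  have key2 := key
  rw [intervalIntegral.integral_add i1 i2, intervalIntegral.integral_of_le hT,
    intervalIntegral.integral_of_le hT, integral_Ioc_eq_integral_Ioo,
    integral_Ioc_eq_integral_Ioo] at key2
  exact eq_neg_of_add_eq_zero_left key2

/-- A compact subset of an open interval lies in a closed subinterval. -/
theorem exists_Icc_of_isCompact_subset_Ioo {S : Set ℝ} {T : ℝ} (hT : 0 < T) (hS : IsCompact S)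
    (h : S ⊆ Ioo 0 T) : ∃ a b, 0 < a ∧ a ≤ b ∧ b < T ∧ S ⊆ Icc a b := by
  rcases S.eq_empty_or_nonempty with rfl | hne
  · exact ⟨T / 2, T / 2, by linarith, le_rfl, by linarith, by simp⟩
  · refine ⟨sInf S, sSup S, (h (hS.sInf_mem hne)).1, ?_, (h (hS.sSup_mem hne)).2, fun x hx =>
      ⟨csInf_le hS.bddBelow hx, le_csSup hS.bddAbove hx⟩⟩
    exact csInf_le_csSup hne hS.bddBelow hS.bddAbove

/-- A smooth function with compact support in `(0,T)` and zero mean has a primitive of the same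
kind. -/
theorem exists_primitive {θ : ℝ → ℝ} {T : ℝ} (hT : 0 < T) (hθ : ContDiff ℝ ∞ θ)
    (hc : HasCompactSupport θ) (hs : tsupport θ ⊆ Ioo 0 T) (h0 : ∫ t, θ t = 0) :
    ∃ η : ℝ → ℝ, ContDiff ℝ ∞ η ∧ HasCompactSupport η ∧ tsupport η ⊆ Ioo 0 T ∧ deriv η = θ := by
  obtain ⟨a, b, ha, hab, hb, hS⟩ := exists_Icc_of_isCompact_subset_Ioo hT hc hs
  have hθz : ∀ t, t ∉ Icc a b → θ t = 0 := fun t ht =>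
    image_eq_zero_of_notMem_tsupport fun h => ht (hS h)
  have hd : ∀ t, HasDerivAt (fun t => ∫ s in a..t, θ s) (θ t) t := fun t =>
    hθ.continuous.integral_hasStrictDerivAt a t |>.hasDerivAt
  have hde : deriv (fun t => ∫ s in a..t, θ s) = θ := funext fun t => (hd t).deriv
  have hz : ∀ t, t ∉ Icc a b → ∫ s in a..t, θ s = 0 := by
    intro t ht
    rcases lt_or_ge t a with h | h
    · refine intervalIntegral.integral_zero_ae (Eventually.of_forall fun s hs => ?_)
      rw [uIoc_of_ge h.le] at hs
      rcases eq_or_lt_of_le hs.2 with e | e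
      · rw [e]
        -- The endpoint `a` may lie in the support interval, so `θ a = 0` is obtained by continuity
        -- from the left.
        have hcl : IsClosed {x | θ x = 0} := isClosed_eq hθ.continuous continuous_const
        have hsub : Iio a ⊆ {x | θ x = 0} := fun x hx => hθz x fun h' => not_lt.2 h'.1 hx
        have := hcl.closure_subset_iff.2 hsub
        rw [closure_Iio] at this
        exact this (show a ≤ a from le_rfl)
      · exact hθz s fun h' => not_lt.2 h'.1 e
    · have hbt : b < t := not_le.1 fun h' => ht ⟨h, h'⟩
      -- Beyond `b` the primitive is the full integral of `θ`; here the zero mean enters.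
      rw [intervalIntegral.integral_of_le h, ← h0, ← integral_Icc_eq_integral_Ioc]
      refine setIntegral_eq_integral_of_forall_compl_eq_zero fun x hx => hθz x fun h' => hx ?_
      exact ⟨h'.1, h'.2.trans hbt.le⟩
  have hsup : tsupport (fun t => ∫ s in a..t, θ s) ⊆ Icc a b :=
    closure_minimal (fun t ht => by_contra fun h => ht (hz t h)) isClosed_Icc
  refine ⟨_, ?_, ?_, hsup.trans fun x hx => ⟨ha.trans_le hx.1, hx.2.trans_lt hb⟩, hde⟩
  · rw [contDiff_infty_iff_deriv, hde]
    exact ⟨fun t => (hd t).differentiableAt, hθ⟩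
  · exact isCompact_Icc.of_isClosed_subset (isClosed_tsupport _) hsup

/-- The lemma of du Bois-Reymond. -/
theorem exists_ae_eq_const_of_integral_deriv_smul {u : ℝ → E} {T : ℝ} (hT : 0 < T)
    (hu : IntegrableOn u (Ioo 0 T))
    (h : ∀ η : ℝ → ℝ, ContDiff ℝ ∞ η → HasCompactSupport η → tsupport η ⊆ Ioo 0 T →
      ∫ t in Ioo 0 T, deriv η t • u t = 0) :
    ∃ c : E, ∀ᵐ t ∂(volume.restrict (Ioo 0 T)), u t = c := by
  let φ : ContDiffBump (T / 2) := ⟨T / 8, T / 4, by positivity, by linarith⟩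
  set η₀ : ℝ → ℝ := φ.normed volume with hη₀
  have h1 : ContDiff ℝ ∞ η₀ := φ.contDiff_normed
  have h2 : HasCompactSupport η₀ := φ.hasCompactSupport_normed
  have h3 : tsupport η₀ ⊆ Ioo 0 T := by
    rw [hη₀, φ.tsupport_normed_eq, Real.closedBall_eq_Icc]
    intro x hx
    have e : φ.rOut = T / 4 := rfl
    rw [e] at hx
    exact ⟨by linarith [hx.1], by linarith [hx.2]⟩
  have h4 : ∫ t, η₀ t = 1 := φ.integral_normed
  have hint : ∀ ψ : ℝ → ℝ, ContDiff ℝ ∞ ψ → HasCompactSupport ψ →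
      IntegrableOn (fun t => ψ t • u t) (Ioo 0 T) := by
    intro ψ hψ hψc
    obtain ⟨C, hC⟩ := hψ.continuous.bounded_above_of_compact_support hψc
    exact hu.bdd_smul C hψ.continuous.aestronglyMeasurable (Eventually.of_forall hC)
  -- As `η₀` has integral one, a constant `u` must equal this weighted mean.
  refine ⟨∫ t in Ioo 0 T, η₀ t • u t, ?_⟩
  rw [ae_restrict_iff' measurableSet_Ioo]
  have main := isOpen_Ioo (a := (0 : ℝ)) (b := T) |>.ae_eq_zero_of_integral_contDiff_smul_eq_zero
    (f := fun t => u t - ∫ t in Ioo 0 T, η₀ t • u t) (μ := volume)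
    ((hu.sub (integrableOn_const (by simp))).locallyIntegrableOn) (by
      intro ψ hψ hψc hψs
      have hzero : ∀ t, t ∉ Ioo 0 T → ψ t = 0 := fun t ht =>
        image_eq_zero_of_notMem_tsupport fun h => ht (hψs h)
      rw [← setIntegral_eq_integral_of_forall_compl_eq_zero (s := Ioo 0 T)
        (fun t ht => by rw [hzero t ht, zero_smul])]
      have iψ : Integrable ψ := hψ.continuous.integrable_of_hasCompactSupport hψc
      have iη : Integrable η₀ := h1.continuous.integrable_of_hasCompactSupport h2
      set m := ∫ t, ψ t with hm
      -- Removing its mean through `η₀` turns an arbitrary test function into the derivative of an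
      -- admissible one.
      have hmean : ∫ t, (ψ t - m * η₀ t) = 0 := by
        rw [integral_sub iψ (iη.const_mul m), integral_const_mul, h4, ← hm]; ring
      have hsm : HasCompactSupport fun t => m * η₀ t := h2.mul_left (f := fun _ => m)
      have hsup : tsupport (fun t => ψ t - m * η₀ t) ⊆ Ioo 0 T := by
        refine (tsupport_sub ψ (fun t => m * η₀ t)).trans (union_subset hψs ?_)
        exact (tsupport_mul_subset_right (f := fun _ => m)).trans h3
      obtain ⟨η, e1, e2, e3, e4⟩ := exists_primitive hT (hψ.sub (contDiff_const.mul h1))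
        (hψc.sub hsm) hsup hmean
      have := h η e1 e2 e3
      rw [e4] at this
      simp only [sub_smul, mul_smul] at this
      have hm0 : IntegrableOn (fun t => m • η₀ t • u t) (Ioo 0 T) := (hint η₀ h1 h2).smul m
      rw [integral_sub (hint ψ hψ hψc) hm0, integral_smul] at this
      simp only [smul_sub]
      rw [integral_sub (hint ψ hψ hψc) (iψ.integrableOn.smul_const _), integral_smul_const]
      rw [setIntegral_eq_integral_of_forall_compl_eq_zero (s := Ioo 0 T) hzero]
      exact this)
  filter_upwards [main] with t ht h'
  exact sub_eq_zero.1 (ht h')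

end TimeCalculus

/-- By integration by parts, `u` and the primitive of `g` have the same weak derivative, so du
Bois-Reymond applies to their difference. -/
theorem IsTimeDeriv.exists_eq_add_integral {E : Type} [NormedAddCommGroup E] [NormedSpace ℝ E]
    [CompleteSpace E] {T : ℝ} (hT : 0 < T) {u g : ℝ → E} (h : IsTimeDeriv T u g)
    (hu : IntegrableOn u (Ioo 0 T)) (hg : IntegrableOn g (Ioo 0 T)) :
    ∃ c : E, ∀ᵐ t ∂(volume.restrict (Ioo 0 T)), u t = c + ∫ s in (0 : ℝ)..t, g s := by
  have hi := intervalIntegrable_of_integrableOn_Ioo hT.le hg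
  have hG : IntegrableOn (fun t => ∫ s in (0 : ℝ)..t, g s) (Ioo 0 T) := by
    have := (absolutelyContinuousOnInterval_integral hi).continuousOn
    rw [uIcc_of_le hT.le] at this
    exact this.integrableOn_Icc.mono_set Ioo_subset_Icc_self
  obtain ⟨c, hc⟩ := exists_ae_eq_const_of_integral_deriv_smul hT (hu.sub hG) (by
    intro η h1 h2 h3
    obtain ⟨C, hC⟩ := (h1.continuous_deriv (by simp)).bounded_above_of_compact_support h2.deriv
    have hm := (h1.continuous_deriv (by simp)).aestronglyMeasurable
      (μ := volume.restrict (Ioo 0 T))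
    have k1 : IntegrableOn (fun t => deriv η t • u t) (Ioo 0 T) :=
      hu.bdd_smul C hm (Eventually.of_forall hC)
    have k2 : IntegrableOn (fun t => deriv η t • ∫ s in (0 : ℝ)..t, g s) (Ioo 0 T) :=
      hG.bdd_smul C hm (Eventually.of_forall hC)
    simp only [Pi.sub_apply, smul_sub]
    rw [integral_sub k1 k2, h η h1 h2 h3,
      integral_deriv_smul_integral hT.le hg h1 h3, sub_self])
  refine ⟨c, ?_⟩
  filter_upwards [hc] with t ht
  rw [← ht]; simp

/-! ### Energy identity and Gronwall's lemma -/

/-- Energy identity for the primitive of an integrable function with values in a Hilbert space. -/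
theorem norm_sq_integral_eq {H : Type*} [NormedAddCommGroup H] [InnerProductSpace ℝ H]
    [CompleteSpace H] {g : ℝ → H} {T : ℝ} (hT : 0 ≤ T) (hg : IntegrableOn g (Ioo 0 T)) :
    IntervalIntegrable (fun s => (inner ℝ (g s) (∫ r in (0 : ℝ)..s, g r) : ℝ)) volume 0 T ∧
    ∀ t ∈ Icc 0 T, ‖∫ s in (0 : ℝ)..t, g s‖ ^ 2
      = 2 * ∫ s in (0 : ℝ)..t, (inner ℝ (g s) (∫ r in (0 : ℝ)..s, g r) : ℝ) := by
  have hi := intervalIntegrable_of_integrableOn_Ioo hT hg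
  have hG := absolutelyContinuousOnInterval_integral hi
  obtain ⟨C, hC⟩ := hG.exists_bound
  set G : ℝ → H := fun t => ∫ s in (0 : ℝ)..t, g s with hGdef
  have hC0 : 0 ≤ C := (norm_nonneg _).trans (hC 0 left_mem_uIcc)
  have hii : IntervalIntegrable (fun s => (inner ℝ (g s) (G s) : ℝ)) volume 0 T := by
    rw [intervalIntegrable_iff_integrableOn_Ioo_of_le hT] at hi ⊢
    have hGm : AEStronglyMeasurable G (volume.restrict (Ioo 0 T)) := by
      refine (hG.continuousOn.mono ?_).aestronglyMeasurable measurableSet_Ioo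
      rw [uIcc_of_le hT]; exact Ioo_subset_Icc_self
    refine (hi.norm.mul_const C).mono' (hi.1.inner hGm) ?_
    filter_upwards [ae_restrict_mem measurableSet_Ioo] with s hs
    refine (norm_inner_le_norm _ _).trans ?_
    gcongr
    exact hC s (by rw [uIcc_of_le hT]; exact Ioo_subset_Icc_self hs)
  refine ⟨hii, fun t ht => ?_⟩
  -- On a ball of radius `C` the squared norm is Lipschitz with constant `2 * C`, so it preserves
  -- absolute continuity.
  have hsq : AbsolutelyContinuousOnInterval (fun t => ‖G t‖ ^ 2) 0 T := by
    refine absolutelyContinuousOnInterval_of_dist_le (hG.const_smul (2 * C)) fun x hx y hy => ?_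
    rw [Real.dist_eq, dist_eq_norm, ← smul_sub, norm_smul, Real.norm_of_nonneg (by positivity)]
    have e : ‖G x‖ ^ 2 - ‖G y‖ ^ 2 = (‖G x‖ + ‖G y‖) * (‖G x‖ - ‖G y‖) := by ring
    rw [e, abs_mul, abs_of_nonneg (by positivity)]
    exact mul_le_mul (by linarith [hC x hx, hC y hy]) (abs_norm_sub_norm_le _ _) (abs_nonneg _)
      (by positivity)
  have key := sub_eq_of_ae_hasDerivAt hT hsq
    (absolutelyContinuousOnInterval_integral (hii.const_mul 2))
    (f' := fun t => 2 * inner ℝ (g t) (G t)) (by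
      filter_upwards [hi.ae_hasDerivAt_integral] with t h ht
      have := (h ht 0 left_mem_uIcc).norm_sq
      rw [real_inner_comm]; exact this) (by
      filter_upwards [(hii.const_mul 2).ae_hasDerivAt_integral] with t h ht
      exact h ht 0 left_mem_uIcc) t ht
  simp only [hGdef, intervalIntegral.integral_same, norm_zero] at key
  rw [intervalIntegral.integral_const_mul] at key
  linarith

/-- Gronwall's lemma with an integrable coefficient and zero initial value. -/
theorem eq_zero_of_le_integral_mul {y a : ℝ → ℝ} {T : ℝ} (hT : 0 < T)
    (hy : ContinuousOn y (Icc 0 T)) (hy0 : ∀ t ∈ Icc 0 T, 0 ≤ y t)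
    (ha : IntegrableOn a (Ioo 0 T)) (ha0 : ∀ t, 0 ≤ a t)
    (h : ∀ t ∈ Icc 0 T, y t ≤ ∫ s in (0 : ℝ)..t, a s * y s) :
    ∀ t ∈ Icc 0 T, y t = 0 := by
  have hi := intervalIntegrable_of_integrableOn_Ioo hT.le ha
  have hsub : ∀ p ∈ Icc 0 T, ∀ q ∈ Icc 0 T, uIcc p q ⊆ Icc 0 T := fun p hp q hq =>
    OrdConnected.uIcc_subset ordConnected_Icc hp hq
  have hia : ∀ p ∈ Icc 0 T, ∀ q ∈ Icc 0 T, IntervalIntegrable a volume p q := fun p hp q hq =>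
    hi.mono_set (by rw [uIcc_of_le hT.le]; exact hsub p hp q hq)
  have hiy : ∀ p ∈ Icc 0 T, ∀ q ∈ Icc 0 T,
      IntervalIntegrable (fun s => a s * y s) volume p q := fun p hp q hq =>
    (hia p hp q hq).mul_continuousOn (hy.mono (hsub p hp q hq))
  have m0 : (0 : ℝ) ∈ Icc 0 T := ⟨le_rfl, hT.le⟩
  -- Continuous induction instead of an exponential factor: the times up to which `y` vanishes form
  -- a closed set that can always be prolonged to the right.
  let S : Set ℝ := {t | ∀ s ∈ Icc 0 t, y s = 0}
  have hA : ContinuousOn (fun t => ∫ s in (0 : ℝ)..t, a s) (Icc 0 T) := by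
    have := (hi.absolutelyContinuousOnInterval_intervalIntegral left_mem_uIcc).continuousOn
    rwa [uIcc_of_le hT.le] at this
  have hclosed : IsClosed (S ∩ Icc 0 T) := by
    have e : S ∩ Icc 0 T = {t ∈ Icc 0 T | ∀ s ∈ Icc 0 t, y s = 0} := by
      ext t; exact and_comm
    rw [e]
    refine isClosed_of_closure_subset fun t ht => ?_
    have htI : t ∈ Icc 0 T := closure_minimal (fun x hx => hx.1) isClosed_Icc ht
    have hlt : ∀ s ∈ Ico 0 t, y s = 0 := by
      intro s hs
      obtain ⟨r, hr, hr'⟩ := mem_closure_iff.1 ht (Ioi s) isOpen_Ioi hs.2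
      exact hr'.2 s ⟨hs.1, hr.le⟩
    refine ⟨htI, fun s hs => ?_⟩
    -- At the limit time itself the integral bound only sees earlier times, where `y` is already
    -- zero.
    rcases eq_or_lt_of_le hs.2 with rfl | hlt'
    · refine le_antisymm ((h s htI).trans (le_of_eq ?_)) (hy0 s htI)
      rw [intervalIntegral.integral_of_le hs.1, integral_Ioc_eq_integral_Ioo]
      exact setIntegral_eq_zero_of_forall_eq_zero fun r hr => by
        rw [hlt r ⟨hr.1.le, hr.2⟩, mul_zero]
    · exact hlt s ⟨hs.1, hlt'⟩
  have hS : Icc 0 T ⊆ S := by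
    refine hclosed.Icc_subset_of_forall_exists_gt (fun s hs => ?_) ?_
    · obtain rfl : s = 0 := le_antisymm hs.2 hs.1
      exact le_antisymm (by simpa using h 0 m0) (hy0 0 m0)
    rintro x ⟨hxS, hx0, hxT⟩ z hz
    have mx : x ∈ Icc 0 T := ⟨hx0, hxT.le⟩
    have hev : ∀ᶠ t in 𝓝[>] x, (∫ s in x..t, a s) < 1 / 2 ∧ t < T ∧ t < z ∧ x < t := by
      have hc : Tendsto (fun t => (∫ s in (0 : ℝ)..t, a s) - ∫ s in (0 : ℝ)..x, a s) (𝓝[>] x)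
          (𝓝 0) := by
        have h1 : Tendsto (fun t => ∫ s in (0 : ℝ)..t, a s) (𝓝[>] x)
            (𝓝 (∫ s in (0 : ℝ)..x, a s)) :=
          (hA x mx).mono_left (nhdsWithin_le_of_mem (by
            filter_upwards [Ioo_mem_nhdsGT hxT] with t ht
            exact ⟨hx0.trans ht.1.le, ht.2.le⟩))
        simpa using h1.sub_const (∫ s in (0 : ℝ)..x, a s)
      filter_upwards [hc.eventually (gt_mem_nhds (show (0 : ℝ) < 1 / 2 by norm_num)),
        Ioo_mem_nhdsGT hxT, Ioo_mem_nhdsGT hz] with t h1 h2 h3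
      refine ⟨?_, h2.2, h3.2, h2.1⟩
      rwa [intervalIntegral.integral_interval_sub_left
        (hia 0 m0 t ⟨hx0.trans h2.1.le, h2.2.le⟩) (hia 0 m0 x mx)] at h1
    obtain ⟨t, ht1, htT, htz, hxt⟩ := hev.exists
    have mt : t ∈ Icc 0 T := ⟨hx0.trans hxt.le, htT.le⟩
    refine ⟨t, ?_, hxt, htz.le⟩
    obtain ⟨q, hq, hqmax⟩ := (isCompact_Icc (a := x) (b := t)).exists_isMaxOn
      ⟨x, le_rfl, hxt.le⟩ (hy.mono fun s hs => ⟨hx0.trans hs.1, hs.2.trans htT.le⟩)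
    have mq : q ∈ Icc 0 T := ⟨hx0.trans hq.1, hq.2.trans htT.le⟩
    have e1 : y q ≤ ∫ s in x..q, a s * y s := by
      refine (h q mq).trans (le_of_eq ?_)
      rw [← intervalIntegral.integral_add_adjacent_intervals (hiy 0 m0 x mx) (hiy x mx q mq)]
      have : ∫ s in (0 : ℝ)..x, a s * y s = 0 := by
        rw [intervalIntegral.integral_of_le hx0]
        exact setIntegral_eq_zero_of_forall_eq_zero fun r hr => by
          rw [hxS r ⟨hr.1.le, hr.2⟩, mul_zero]
      rw [this, zero_add]
    have e2 : ∫ s in x..q, a s * y s ≤ ∫ s in x..q, a s * y q := by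
      refine intervalIntegral.integral_mono_on hq.1 (hiy x mx q mq)
        ((hia x mx q mq).mul_const _) fun s hs => ?_
      exact mul_le_mul_of_nonneg_left (hqmax ⟨hs.1, hs.2.trans hq.2⟩) (ha0 s)
    have e3 : ∫ s in x..q, a s ≤ ∫ s in x..t, a s := by
      rw [← intervalIntegral.integral_add_adjacent_intervals (hia x mx q mq) (hia q mq t mt)]
      linarith [intervalIntegral.integral_nonneg (f := a) (μ := volume) hq.2 fun s _ => ha0 s]
    rw [intervalIntegral.integral_mul_const] at e2
    have hq0 := hy0 q mq
    have e4 : y q = 0 := by nlinarith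
    intro s hs
    rcases le_total s x with hsx | hsx
    · exact hxS s ⟨hs.1, hsx⟩
    · refine le_antisymm ?_ (hy0 s ⟨hs.1, hs.2.trans htT.le⟩)
      rw [← e4]; exact hqmax ⟨hsx, hs.2⟩
  exact fun t ht => hS ht t ⟨ht.1, le_rfl⟩

/-! ### Geometry of Lipschitz domains -/

/-- The segments of unit length in direction `d` that start in `U ∩ Ω` stay in `Ω`. -/
def PointsInto (Ω U : Set Plane) (d : Plane) : Prop :=
  ∀ y ∈ U ∩ Ω, ∀ s ∈ Icc (0 : ℝ) 1, y + s • d ∈ Ω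

theorem linearIndependent_fin_two {d : Fin 2 → Plane}
    (h : ∀ p q : ℝ, p • d 0 + q • d 1 = 0 → p = 0 ∧ q = 0) : LinearIndependent ℝ d := by
  refine Fintype.linearIndependent_iff.2 fun g hg => ?_
  rw [Fin.sum_univ_two] at hg
  have := h _ _ hg
  intro i
  fin_cases i
  exacts [this.1, this.2]

theorem exists_pointsInto_of_mem {Ω : Set Plane} (hΩ : IsOpen Ω) {x : Plane} (hx : x ∈ Ω) :
    ∃ U ∈ 𝓝 x, ∃ d : Fin 2 → Plane, LinearIndependent ℝ d ∧ ∀ i, PointsInto Ω U (d i) := by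
  obtain ⟨r, hr, hb⟩ := Metric.isOpen_iff.1 hΩ x hx
  refine ⟨Metric.ball x (r / 2), Metric.ball_mem_nhds x (by positivity),
    fun i => (r / 4) • unitVec i, ?_, fun i y hy s hs => hb ?_⟩
  · refine linearIndependent_fin_two fun p q hpq => ?_
    have h0 := congrArg (fun z : Plane => z 0) hpq
    have h1 := congrArg (fun z : Plane => z 1) hpq
    simpa [hr.ne'] using And.intro h0 h1
  · have h1 : dist (y + s • (r / 4) • unitVec i) y ≤ r / 4 := by
      rw [dist_eq_norm, add_sub_cancel_left, norm_smul, norm_smul, Real.norm_of_nonneg hs.1,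
        Real.norm_of_nonneg (by positivity : (0 : ℝ) ≤ r / 4)]
      simp only [unitVec, PiLp.norm_single, norm_one, mul_one]
      nlinarith [hs.2]
    have h2 : dist y x < r / 2 := hy.1
    rw [Metric.mem_ball]
    linarith [dist_triangle (y + s • (r / 4) • unitVec i) y x]

/-- In the graph coordinates, the directions `(1, -k)` and `(-1, -k)` descend at least as steeply as
the graph can, so a point below the graph stays below it. -/
theorem exists_pointsInto_of_mem_frontier {Ω : Set Plane} (hΩ : HasLipschitzBoundary Ω)
    {x : Plane} (hx : x ∈ frontier Ω) :
    ∃ U ∈ 𝓝 x, ∃ d : Fin 2 → Plane, LinearIndependent ℝ d ∧ ∀ i, PointsInto Ω U (d i) := by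
  obtain ⟨e, g, K, r, hr, hg, H⟩ := hΩ x hx
  -- Adding one keeps `k` positive even when `K = 0`; otherwise the two directions would be
  -- parallel.
  set k : ℝ := K + 1 with hk
  have hk0 : 0 ≤ (K : ℝ) := K.2
  let c : Fin 2 → Plane := fun i => !₂[if i = 0 then 1 else -1, -k]
  obtain ⟨M, hM0, hM⟩ : ∃ M : ℝ, 0 < M ∧ ∀ i, ‖c i‖ ≤ M :=
    ⟨‖c 0‖ + ‖c 1‖ + 1, by positivity, fun i => by
      fin_cases i
      · show ‖c 0‖ ≤ _
        linarith [norm_nonneg (c 1)]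
      · show ‖c 1‖ ≤ _
        linarith [norm_nonneg (c 0)]⟩
  -- With this scaling a unit segment moves a point by at most `r / 4`, so from the ball of radius
  -- `r / 2` it stays in the ball where the graph describes `Ω`.
  set h : ℝ := r / (4 * M) with hh
  have hh0 : 0 < h := by positivity
  have hhM : h * M = r / 4 := by rw [hh]; field_simp
  let L := e.linearIsometryEquiv
  refine ⟨Metric.ball x (r / 2), Metric.ball_mem_nhds x (by positivity),
    fun i => L.symm (h • c i), ?_, fun i y hy s hs => ?_⟩
  · have hc : LinearIndependent ℝ c := by
      refine linearIndependent_fin_two fun p q hpq => ?_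
      have h0 := congrArg (fun z : Plane => z 0) hpq
      have h1 := congrArg (fun z : Plane => z 1) hpq
      simp [c] at h0 h1
      have h2 : (p + q) * k = 0 := by linarith
      have h3 : p + q = 0 := (mul_eq_zero.1 h2).resolve_right (by positivity)
      exact ⟨by linarith, by linarith⟩
    have h2 := (hc.units_smul (fun _ => Units.mk0 h hh0.ne')).map' L.symm.toLinearEquiv.toLinearMap
      (LinearMap.ker_eq_bot.2 L.symm.injective)
    exact h2
  · have h1 : dist (y + s • L.symm (h • c i)) y ≤ r / 4 := by
      rw [dist_eq_norm, add_sub_cancel_left, norm_smul, L.symm.norm_map, norm_smul,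
        Real.norm_of_nonneg hs.1, Real.norm_of_nonneg hh0.le]
      have : h * ‖c i‖ ≤ h * M := mul_le_mul_of_nonneg_left (hM i) hh0.le
      have : 0 ≤ h * ‖c i‖ := by positivity
      nlinarith [hs.1, hs.2]
    have h2 : dist y x < r / 2 := hy.1
    have hyb : y ∈ Metric.ball x r := by rw [Metric.mem_ball]; linarith
    have hzb : y + s • L.symm (h • c i) ∈ Metric.ball x r := by
      rw [Metric.mem_ball]
      linarith [dist_triangle (y + s • L.symm (h • c i)) y x]
    have h3 := (H y hyb).1 hy.2
    have he : e (y + s • L.symm (h • c i)) = e y + s • h • c i := by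
      have := e.map_vadd y (s • L.symm (h • c i))
      rw [vadd_eq_add, vadd_eq_add, add_comm] at this
      rw [this, add_comm, map_smul]
      simp [L]
    rw [H _ hzb, he]
    set t := s * h with ht
    have ht0 : 0 ≤ t := mul_nonneg hs.1 hh0.le
    set σ : ℝ := if i = 0 then 1 else -1 with hσ
    have hσ1 : |σ| = 1 := by rw [hσ]; split_ifs <;> simp
    have e0 : (e y + s • h • c i) 0 = e y 0 + t * σ := by
      simp [c, ht, hσ]
    have e1 : (e y + s • h • c i) 1 = e y 1 - t * k := by
      simp [c, ht, mul_assoc, sub_eq_add_neg]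
    rw [e0, e1]
    have hl := hg.dist_le_mul (e y 0) (e y 0 + t * σ)
    rw [Real.dist_eq, Real.dist_eq, sub_add_cancel_left, abs_neg, abs_mul, hσ1, abs_of_nonneg ht0,
      mul_one] at hl
    have := (abs_le.1 hl).2
    nlinarith

theorem exists_pointsInto {Ω : Set Plane} (ho : IsOpen Ω) (hΩ : HasLipschitzBoundary Ω)
    {x : Plane} (hx : x ∈ closure Ω) :
    ∃ U ∈ 𝓝 x, ∃ d : Fin 2 → Plane, LinearIndependent ℝ d ∧ ∀ i, PointsInto Ω U (d i) := by
  by_cases h : x ∈ Ω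
  · exact exists_pointsInto_of_mem ho h
  · exact exists_pointsInto_of_mem_frontier hΩ (by rw [ho.frontier_eq]; exact ⟨hx, h⟩)

/-! ### The Ladyzhenskaya inequality -/

/-- Tonelli's theorem in the coordinates given by two independent directions. -/
theorem exists_lintegral_mul_lintegral_line_le {d : Fin 2 → Plane} (hd : LinearIndependent ℝ d) :
    ∃ C : ℝ≥0, ∀ g : Plane → ℝ≥0∞, Measurable g →
      ∫⁻ x, (∫⁻ s : ℝ, g (x + s • d 0)) * (∫⁻ s : ℝ, g (x + s • d 1)) ≤ C * (∫⁻ x, g x) ^ 2 := by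
  let b : Module.Basis (Fin 2) ℝ Plane := basisOfLinearIndependentOfCardEqFinrank hd (by simp)
  have hb : ∀ i, b i = d i := fun i => by simp [b]
  let A : (ℝ × ℝ) ≃L[ℝ] Plane :=
    ((LinearEquiv.finTwoArrow ℝ ℝ).symm.trans b.equivFun.symm).toContinuousLinearEquiv
  have hA : ∀ p q : ℝ, A (p, q) = p • d 0 + q • d 1 := by
    intro p q
    have : A (p, q) = b.equivFun.symm ![p, q] := rfl
    rw [this, Module.Basis.equivFun_symm_apply]
    simp [hb]
  let e : ℝ × ℝ ≃ᵐ Plane := A.toHomeomorph.toMeasurableEquiv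
  have hH : (Measure.map e volume).IsAddHaarMeasure :=
    A.isAddHaarMeasure_map volume
  set c : ℝ≥0 := Measure.addHaarScalarFactor (volume : Measure Plane) (Measure.map e volume)
    with hc
  set c' : ℝ≥0 := Measure.addHaarScalarFactor (Measure.map e volume) (volume : Measure Plane)
    with hc'
  have h1 : (volume : Measure Plane) = c • Measure.map e volume :=
    Measure.isAddLeftInvariant_eq_smul _ _
  have h2 : Measure.map e volume = c' • (volume : Measure Plane) :=
    Measure.isAddLeftInvariant_eq_smul _ _
  refine ⟨c * c' ^ 2, fun g hg => ?_⟩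
  have hgA : Measurable fun z : ℝ × ℝ => g (A z) := hg.comp A.continuous.measurable
  have hI : ∫⁻ p, ∫⁻ q, g (A (p, q)) = c' * ∫⁻ x, g x := by
    rw [← lintegral_prod (fun z : ℝ × ℝ => g (A z)) hgA.aemeasurable]
    have : ∫⁻ z : ℝ × ℝ, g (A z) = ∫⁻ x, g x ∂(Measure.map e volume) :=
      (lintegral_map_equiv g e).symm
    change ∫⁻ z : ℝ × ℝ, g (A z) = _
    rw [this, h2, lintegral_smul_measure]
    rfl
  have hI' : ∫⁻ q, ∫⁻ p, g (A (p, q)) = c' * ∫⁻ x, g x := by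
    rw [← hI]
    exact lintegral_lintegral_swap (f := fun q p => g (A (p, q)))
      (hgA.comp measurable_swap).aemeasurable
  -- A line integral in one direction depends only on the other coordinate, so the product below
  -- separates.
  have s0 : ∀ p q : ℝ, ∫⁻ s : ℝ, g (A (p, q) + s • d 0) = ∫⁻ s : ℝ, g (A (s, q)) := by
    intro p q
    rw [← lintegral_add_left_eq_self (μ := volume) (fun s => g (A (s, q))) p]
    refine lintegral_congr fun s => ?_
    rw [hA, hA, add_smul]; congr 1; abel
  have s1 : ∀ p q : ℝ, ∫⁻ s : ℝ, g (A (p, q) + s • d 1) = ∫⁻ s : ℝ, g (A (p, s)) := by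
    intro p q
    rw [← lintegral_add_left_eq_self (μ := volume) (fun s => g (A (p, s))) q]
    refine lintegral_congr fun s => ?_
    rw [hA, hA, add_smul]; congr 1; abel
  have m1 : Measurable fun p : ℝ => ∫⁻ s : ℝ, g (A (p, s)) := hgA.lintegral_prod_right'
  have m0 : Measurable fun q : ℝ => ∫⁻ s : ℝ, g (A (s, q)) := hgA.lintegral_prod_left'
  have key : ∫⁻ x, (∫⁻ s : ℝ, g (x + s • d 0)) * (∫⁻ s : ℝ, g (x + s • d 1))
      = c * ∫⁻ z : ℝ × ℝ, (∫⁻ s : ℝ, g (A (s, z.2))) * (∫⁻ s : ℝ, g (A (z.1, s))) := by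
    conv_lhs => rw [h1]
    rw [lintegral_smul_measure, lintegral_map_equiv]
    rw [ENNReal.smul_def, smul_eq_mul]
    congr 1
    refine lintegral_congr fun z => ?_
    rw [← s0 z.1 z.2, ← s1 z.1 z.2]; rfl
  rw [key]
  have : ∫⁻ z : ℝ × ℝ, (∫⁻ s : ℝ, g (A (s, z.2))) * (∫⁻ s : ℝ, g (A (z.1, s)))
      = (∫⁻ p, ∫⁻ q, g (A (p, q))) * (∫⁻ q, ∫⁻ p, g (A (p, q))) := by
    rw [← lintegral_prod_mul m1.aemeasurable m0.aemeasurable]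
    exact lintegral_congr fun z => mul_comm _ _
  rw [this, hI, hI']
  push_cast
  exact le_of_eq (by ring)

/-- A `C¹` function is bounded by its mean and the mean of its derivative on a segment. -/
theorem enorm_le_lintegral_segment {F : Plane → ℝ} (hF : ContDiff ℝ 1 F) (x d : Plane) :
    ‖F x‖ₑ ≤ ∫⁻ s in Icc (0 : ℝ) 1, (‖F (x + s • d)‖ₑ + ‖fderiv ℝ F (x + s • d)‖ₑ * ‖d‖ₑ) := by
  set γ : ℝ → Plane := fun s => x + s • d
  have hγ : ∀ s, HasDerivAt γ d s := fun s => by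
    simpa [γ] using! ((hasDerivAt_id s).smul_const d).const_add x
  have hγc : Continuous γ := by fun_prop
  have hFd : ∀ s, HasDerivAt (fun s => F (γ s)) (fderiv ℝ F (γ s) d) s := fun s =>
    ((hF.differentiable (by simp) (γ s)).hasFDerivAt).comp_hasDerivAt s (hγ s)
  have hcF : Continuous fun s => F (γ s) := hF.continuous.comp hγc
  have hcD : Continuous fun s => fderiv ℝ F (γ s) d :=
    ((hF.continuous_fderiv (by simp)).comp hγc).clm_apply continuous_const
  have hmF : Measurable fun s => ‖F (γ s)‖ₑ := hcF.measurable.enorm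
  set D := ∫⁻ s in Icc (0 : ℝ) 1, ‖fderiv ℝ F (γ s)‖ₑ * ‖d‖ₑ with hD
  -- The bound holds at every point of the segment; averaging over `s` then gives the claim.
  have step : ∀ s ∈ Icc (0 : ℝ) 1, ‖F x‖ₑ ≤ ‖F (γ s)‖ₑ + D := by
    intro s hs
    have ftc : ∫ r in (0 : ℝ)..s, fderiv ℝ F (γ r) d = F (γ s) - F (γ 0) :=
      intervalIntegral.integral_eq_sub_of_hasDerivAt (fun r _ => hFd r) (hcD.intervalIntegrable _ _)
    have e : F x = F (γ s) - ∫ r in (0 : ℝ)..s, fderiv ℝ F (γ r) d := by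
      rw [ftc]; simp [γ]
    rw [e]
    refine enorm_sub_le.trans ?_
    gcongr
    rw [intervalIntegral.integral_of_le hs.1]
    refine (enorm_integral_le_lintegral_enorm _).trans ?_
    refine (lintegral_mono fun r => (fderiv ℝ F (γ r)).le_opENorm d).trans ?_
    exact lintegral_mono_set fun r hr => ⟨hr.1.le, hr.2.trans hs.2⟩
  have hvol : volume (Icc (0 : ℝ) 1) = 1 := by simp
  calc ‖F x‖ₑ = ∫⁻ _ in Icc (0 : ℝ) 1, ‖F x‖ₑ := by rw [setLIntegral_const, hvol, mul_one]
    _ ≤ ∫⁻ s in Icc (0 : ℝ) 1, (‖F (γ s)‖ₑ + D) := setLIntegral_mono (hmF.add_const _) step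
    _ = _ := by
      rw [lintegral_add_left hmF, lintegral_add_left hmF, setLIntegral_const,
        hvol, mul_one]

/-- Gagliardo-Nirenberg argument: `|F x|` is bounded by a line integral in each of the two
directions, so `|F x| ^ 2` is bounded by their product. The segments stay in `Ω`, so the integrand
may be cut off outside `Ω`. -/
theorem lintegral_sq_le_of_pointsInto {Ω U : Set Plane} (hΩ : IsOpen Ω) {d : Fin 2 → Plane}
    (hd : LinearIndependent ℝ d) (h : ∀ i, PointsInto Ω U (d i)) :
    ∃ C : ℝ≥0, ∀ F : Plane → ℝ, ContDiff ℝ 1 F →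
      ∫⁻ x in U ∩ Ω, ‖F x‖ₑ ^ 2 ≤ C * (∫⁻ x in Ω, (‖F x‖ₑ + ‖fderiv ℝ F x‖ₑ)) ^ 2 := by
  obtain ⟨C, hC⟩ := exists_lintegral_mul_lintegral_line_le hd
  -- One constant that dominates the weight `1` of the function and the weights `‖d i‖` of its
  -- derivative.
  set κ : ℝ≥0 := 1 + ‖d 0‖₊ + ‖d 1‖₊ with hκ
  have hκ1 : (1 : ℝ≥0) ≤ κ := by
    rw [hκ, add_assoc]; exact le_self_add
  have hκd : ∀ i, ‖d i‖₊ ≤ κ := by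
    intro i
    fin_cases i
    · exact le_add_right le_add_self
    · exact le_add_self
  refine ⟨C * κ ^ 2, fun F hF => ?_⟩
  have hm : Measurable fun x => ‖F x‖ₑ + ‖fderiv ℝ F x‖ₑ :=
    hF.continuous.measurable.enorm.add (hF.continuous_fderiv (by simp)).measurable.enorm
  set g : Plane → ℝ≥0∞ := Ω.indicator fun x => κ * (‖F x‖ₑ + ‖fderiv ℝ F x‖ₑ) with hg
  have hgm : Measurable g := (hm.const_mul _).indicator hΩ.measurableSet
  have line : ∀ i, ∀ x ∈ U ∩ Ω, ‖F x‖ₑ ≤ ∫⁻ s : ℝ, g (x + s • d i) := by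
    intro i x hx
    refine (enorm_le_lintegral_segment hF x (d i)).trans ?_
    refine le_trans (setLIntegral_mono' measurableSet_Icc fun s hs => ?_)
      (setLIntegral_le_lintegral (Icc (0 : ℝ) 1) _)
    rw [hg, indicator_of_mem (h i x hx s hs), mul_add]
    refine add_le_add ?_ ?_
    · exact le_mul_of_one_le_left' (by exact_mod_cast hκ1)
    · rw [mul_comm]
      gcongr
      exact_mod_cast hκd i
  calc ∫⁻ x in U ∩ Ω, ‖F x‖ₑ ^ 2
      ≤ ∫⁻ x in U ∩ Ω, (∫⁻ s : ℝ, g (x + s • d 0)) * (∫⁻ s : ℝ, g (x + s • d 1)) := by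
        refine setLIntegral_mono ?_ fun x hx => ?_
        · have : ∀ i, Measurable fun x : Plane => ∫⁻ s : ℝ, g (x + s • d i) := fun i =>
            Measurable.lintegral_prod_right'
              (f := fun z : Plane × ℝ => g (z.1 + z.2 • d i)) (hgm.comp (by fun_prop))
          exact (this 0).mul (this 1)
        · rw [sq]; exact mul_le_mul' (line 0 x hx) (line 1 x hx)
    _ ≤ ∫⁻ x, (∫⁻ s : ℝ, g (x + s • d 0)) * (∫⁻ s : ℝ, g (x + s • d 1)) :=
        setLIntegral_le_lintegral _ _
    _ ≤ C * (∫⁻ x, g x) ^ 2 := hC g hgm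
    _ = _ := by
        rw [hg, lintegral_indicator hΩ.measurableSet, lintegral_const_mul _ hm, mul_pow]
        push_cast
        ring

/-- The embedding `W^{1,1}(Ω) ⊆ L²(Ω)` for `C¹` functions on the plane. -/
theorem exists_lintegral_sq_le {Ω : Set Plane} (hΩ : IsOpen Ω) (hb : Bornology.IsBounded Ω)
    (hl : HasLipschitzBoundary Ω) :
    ∃ C : ℝ≥0, ∀ F : Plane → ℝ, ContDiff ℝ 1 F →
      ∫⁻ x in Ω, ‖F x‖ₑ ^ 2 ≤ C * (∫⁻ x in Ω, (‖F x‖ₑ + ‖fderiv ℝ F x‖ₑ)) ^ 2 := by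
  let P : Set Plane → Prop := fun S => ∃ C : ℝ≥0, ∀ F : Plane → ℝ, ContDiff ℝ 1 F →
      ∫⁻ x in S ∩ Ω, ‖F x‖ₑ ^ 2 ≤ C * (∫⁻ x in Ω, (‖F x‖ₑ + ‖fderiv ℝ F x‖ₑ)) ^ 2
  -- The local estimates are patched by compactness; no partition of unity is needed, since each
  -- right-hand side is already an integral over all of `Ω`.
  have hP : P (closure Ω) := by
    refine hb.isCompact_closure.induction_on (p := P) ⟨0, fun F _ => by simp⟩ ?_ ?_ ?_
    · rintro s t hst ⟨C, hC⟩
      exact ⟨C, fun F hF => (lintegral_mono_set (inter_subset_inter_left _ hst)).trans (hC F hF)⟩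
    · rintro s t ⟨C, hC⟩ ⟨C', hC'⟩
      refine ⟨C + C', fun F hF => ?_⟩
      rw [union_inter_distrib_right]
      refine (lintegral_union_le _ _ _).trans ?_
      push_cast
      rw [add_mul]
      exact add_le_add (hC F hF) (hC' F hF)
    · intro x hx
      obtain ⟨U, hU, d, hd, hp⟩ := exists_pointsInto hΩ hl hx
      exact ⟨U, mem_nhdsWithin_of_mem_nhds hU, lintegral_sq_le_of_pointsInto hΩ hd hp⟩
  obtain ⟨C, hC⟩ := hP
  refine ⟨C, fun F hF => ?_⟩
  have := hC F hF
  rwa [inter_eq_self_of_subset_right subset_closure] at this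

theorem eLpNorm_four_pow {α F : Type*} [MeasurableSpace α] [NormedAddCommGroup F] (μ : Measure α)
    (f : α → F) : eLpNorm f 4 μ ^ 4 = ∫⁻ x, ‖f x‖ₑ ^ 4 ∂μ := by
  have := eLpNorm_nnreal_pow_eq_lintegral (f := f) (μ := μ) (p := 4) (by norm_num)
  simp only [NNReal.coe_ofNat, ENNReal.coe_ofNat] at this
  exact_mod_cast this

theorem eLpNorm_two_pow {α F : Type*} [MeasurableSpace α] [NormedAddCommGroup F] (μ : Measure α)
    (f : α → F) : eLpNorm f 2 μ ^ 2 = ∫⁻ x, ‖f x‖ₑ ^ 2 ∂μ := by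
  have := eLpNorm_nnreal_pow_eq_lintegral (f := f) (μ := μ) (p := 2) (by norm_num)
  simp only [NNReal.coe_ofNat, ENNReal.coe_ofNat] at this
  exact_mod_cast this

/-- The Ladyzhenskaya inequality for `C¹` fields on the plane. -/
theorem exists_eLpNorm_four_le {Ω : Set Plane} (hΩ : IsOpen Ω) (hb : Bornology.IsBounded Ω)
    (hl : HasLipschitzBoundary Ω) :
    ∃ C : ℝ≥0, ∀ φ : Plane → Plane, ContDiff ℝ 1 φ →
      eLpNorm φ 4 (volume.restrict Ω) ^ 4 ≤ C * (eLpNorm φ 2 (volume.restrict Ω) *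
        (eLpNorm φ 2 (volume.restrict Ω) + eLpNorm (fderiv ℝ φ) 2 (volume.restrict Ω))) ^ 2 := by
  obtain ⟨C, hC⟩ := exists_lintegral_sq_le hΩ hb hl
  refine ⟨C * 2 ^ 2, fun φ hφ => ?_⟩
  set μ := (volume : Measure Plane).restrict Ω
  -- The embedding is applied to `‖φ‖ ^ 2`, whose derivative is at most `2 ‖φ‖ ‖∇φ‖`.
  have hF : ContDiff ℝ 1 fun x => ‖φ x‖ ^ 2 := hφ.norm_sq ℝ
  have hD : ∀ x, ‖fderiv ℝ (fun x => ‖φ x‖ ^ 2) x‖ₑ ≤ 2 * (‖φ x‖ₑ * ‖fderiv ℝ φ x‖ₑ) := by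
    intro x
    have h := ((hφ.differentiable (by simp) x).hasFDerivAt.norm_sq).fderiv
    rw [h]
    have : ‖(2 : ℕ) • (innerSL ℝ (φ x)).comp (fderiv ℝ φ x)‖ ≤ 2 * (‖φ x‖ * ‖fderiv ℝ φ x‖) := by
      refine (norm_nsmul_le).trans ?_
      have := ContinuousLinearMap.opNorm_comp_le (innerSL ℝ (φ x)) (fderiv ℝ φ x)
      rw [innerSL_apply_norm] at this
      push_cast
      linarith
    rw [← ofReal_norm, ← ofReal_norm, ← ofReal_norm]
    refine (ENNReal.ofReal_le_ofReal this).trans ?_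
    rw [ENNReal.ofReal_mul (by norm_num), ENNReal.ofReal_mul (norm_nonneg _)]
    simp
  have hsq : ∀ x, ‖‖φ x‖ ^ 2‖ₑ = ‖φ x‖ₑ ^ 2 := fun x => by rw [enorm_pow, enorm_norm]
  have m0 : Measurable fun x => ‖φ x‖ₑ := hφ.continuous.measurable.enorm
  have m1 : Measurable fun x => ‖fderiv ℝ φ x‖ₑ :=
    (hφ.continuous_fderiv (by simp)).measurable.enorm
  have holder : ∫⁻ x, ‖φ x‖ₑ * ‖fderiv ℝ φ x‖ₑ ∂μ ≤ eLpNorm φ 2 μ * eLpNorm (fderiv ℝ φ) 2 μ := by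
    have := ENNReal.lintegral_mul_le_Lp_mul_Lq μ Real.HolderConjugate.two_two
      m0.aemeasurable m1.aemeasurable
    simpa [eLpNorm_eq_lintegral_rpow_enorm_toReal] using this
  have h := hC _ hF
  calc eLpNorm φ 4 μ ^ 4 = ∫⁻ x in Ω, ‖‖φ x‖ ^ 2‖ₑ ^ 2 := by
        rw [eLpNorm_four_pow]
        refine lintegral_congr fun x => ?_
        rw [hsq, ← pow_mul]
    _ ≤ C * (∫⁻ x in Ω, (‖‖φ x‖ ^ 2‖ₑ + ‖fderiv ℝ (fun x => ‖φ x‖ ^ 2) x‖ₑ)) ^ 2 := h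
    _ ≤ C * (2 * (eLpNorm φ 2 μ * (eLpNorm φ 2 μ + eLpNorm (fderiv ℝ φ) 2 μ))) ^ 2 := by
        gcongr
        calc ∫⁻ x in Ω, (‖‖φ x‖ ^ 2‖ₑ + ‖fderiv ℝ (fun x => ‖φ x‖ ^ 2) x‖ₑ)
            ≤ ∫⁻ x, (‖φ x‖ₑ ^ 2 + 2 * (‖φ x‖ₑ * ‖fderiv ℝ φ x‖ₑ)) ∂μ :=
              lintegral_mono fun x => add_le_add (hsq x).le (hD x)
          _ = eLpNorm φ 2 μ ^ 2 + 2 * ∫⁻ x, ‖φ x‖ₑ * ‖fderiv ℝ φ x‖ₑ ∂μ := by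
              rw [lintegral_add_left (m0.pow_const 2), eLpNorm_two_pow]
              congr 1
              exact lintegral_const_mul _ (m0.mul m1)
          _ ≤ 2 * eLpNorm φ 2 μ ^ 2 + 2 * (eLpNorm φ 2 μ * eLpNorm (fderiv ℝ φ) 2 μ) := by
              gcongr
              exact le_mul_of_one_le_left' one_le_two
          _ = _ := by ring
    _ = _ := by push_cast; ring

/-- The weak gradient of a smooth field is its classical gradient. -/
theorem HasWeakGrad.ae_eq_fderiv {Ω : Set Plane} (hΩ : IsOpen Ω) {u : L2Vec Ω} {G : L2Mat Ω}
    (h : HasWeakGrad Ω u G) {φ : Plane → Plane} (hφ : ContDiff ℝ ∞ φ)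
    (hu : u =ᵐ[volume.restrict Ω] φ) (i j : Fin 2) :
    ∀ᵐ x ∂(volume.restrict Ω), G x (i, j) = fderiv ℝ φ x (unitVec j) i := by
  have hφi : ContDiff ℝ ∞ fun x => φ x i := (contDiff_piLp_apply 2).comp hφ
  have hfd : ∀ x, fderiv ℝ (fun x => φ x i) x (unitVec j) = fderiv ℝ φ x (unitVec j) i := by
    intro x
    have h1 := (hφ.differentiable (by simp) x).hasFDerivAt
    have h2 := ((EuclideanSpace.proj (𝕜 := ℝ) i).hasFDerivAt (x := φ x)).comp x h1
    have h3 : HasFDerivAt (fun x => φ x i) ((EuclideanSpace.proj (𝕜 := ℝ) i).comp (fderiv ℝ φ x)) x :=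
      h2
    rw [h3.fderiv]; rfl
  have hcd : Continuous fun x => fderiv ℝ φ x (unitVec j) i := by
    simp_rw [← hfd]; exact continuous_partial hφi j
  have hGm : MemLp (fun x => G x (i, j)) 2 (volume.restrict Ω) :=
    (EuclideanSpace.proj (𝕜 := ℝ) (i, j)).comp_memLp' (Lp.memLp G)
  have hloc : LocallyIntegrableOn (fun x => G x (i, j) - fderiv ℝ φ x (unitVec j) i) Ω volume := by
    refine LocallyIntegrableOn.sub ?_ (hcd.locallyIntegrable.locallyIntegrableOn Ω)
    exact locallyIntegrableOn_of_locallyIntegrable_restrict (hGm.locallyIntegrable (by norm_num))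
  rw [ae_restrict_iff' hΩ.measurableSet]
  have main := hΩ.ae_eq_zero_of_integral_contDiff_smul_eq_zero hloc (by
    intro χ h1 h2 h3
    have z : ∀ x, x ∉ Ω → χ x = 0 := fun x hx =>
      image_eq_zero_of_notMem_tsupport fun h' => hx (h3 h')
    have zd : ∀ x, x ∉ Ω → fderiv ℝ χ x (unitVec j) = 0 := fun x hx => by
      rw [fderiv_of_notMem_tsupport ℝ (fun h' => hx (h3 h'))]; rfl
    have cχ := continuous_partial h1 j
    have sχ := hasCompactSupport_partial h2 j
    have e1 := h χ h1 h2 h3 i j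
    have e2 : ∫ x in Ω, u x i * fderiv ℝ χ x (unitVec j)
        = ∫ x, φ x i * fderiv ℝ χ x (unitVec j) := by
      refine Eq.trans (integral_congr_ae ?_) (setIntegral_eq_integral_of_forall_compl_eq_zero
        (s := Ω) (μ := volume) (fun x hx => by rw [zd x hx, mul_zero]))
      filter_upwards [hu] with x hx
      rw [hx]
    have i1 : Integrable fun x => fderiv ℝ (fun x => φ x i) x (unitVec j) * χ x :=
      ((continuous_partial hφi j).mul h1.continuous).integrable_of_hasCompactSupport h2.mul_left
    -- The test function has compact support in `Ω`, so integration by parts may be done on the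
    -- whole plane.
    have e3 := integral_mul_fderiv_eq_neg_fderiv_mul_of_integrable (μ := volume)
      (f := fun x => φ x i) (g := χ) (v := unitVec j) i1
      ((hφi.continuous.mul cχ).integrable_of_hasCompactSupport sχ.mul_left)
      ((hφi.continuous.mul h1.continuous).integrable_of_hasCompactSupport h2.mul_left)
      (fun x _ => hφi.differentiable (by simp) x) (fun x _ => h1.differentiable (by simp) x)
    have e4 : ∫ x, fderiv ℝ (fun x => φ x i) x (unitVec j) * χ x
        = ∫ x in Ω, fderiv ℝ (fun x => φ x i) x (unitVec j) * χ x :=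
      (setIntegral_eq_integral_of_forall_compl_eq_zero
        (fun x hx => by rw [z x hx, mul_zero])).symm
    rw [← setIntegral_eq_integral_of_forall_compl_eq_zero (s := Ω) (μ := volume)
      (fun x hx => by rw [z x hx, zero_smul])]
    have e5 : ∫ x in Ω, G x (i, j) * χ x
        = ∫ x in Ω, fderiv ℝ (fun x => φ x i) x (unitVec j) * χ x := by
      rw [← e4]; linarith [e1, e2, e3]
    calc ∫ x in Ω, χ x • (G x (i, j) - fderiv ℝ φ x (unitVec j) i)
        = ∫ x in Ω, (G x (i, j) * χ x - fderiv ℝ (fun x => φ x i) x (unitVec j) * χ x) := by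
          refine integral_congr_ae (Eventually.of_forall fun x => ?_)
          simp only [hfd, smul_eq_mul]; ring
      _ = 0 := by
          rw [integral_sub (integrable_coord_mul G (i, j) h1.continuous h2) i1.integrableOn, e5,
            sub_self])
  filter_upwards [main] with x hx hxΩ
  exact sub_eq_zero.1 (hx hxΩ)

/-- The operator norm is at most the Frobenius norm. This links the classical derivative to the
matrix-valued weak gradient. -/
theorem norm_le_of_forall_apply_eq {A : Plane →L[ℝ] Plane} {M : Mat}
    (h : ∀ i j, M (i, j) = A (unitVec j) i) : ‖A‖ ≤ ‖M‖ := by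
  refine A.opNorm_le_bound (norm_nonneg _) fun z => ?_
  refine abs_le_of_sq_le_sq' ?_ (by positivity) |>.2
  have hz : z = z 0 • unitVec 0 + z 1 • unitVec 1 := by
    ext i; fin_cases i <;> simp
  have hA : ∀ i, A z i = z 0 * M (i, 0) + z 1 * M (i, 1) := by
    intro i
    rw [h, h]
    conv_lhs => rw [hz, map_add, map_smul, map_smul]
    simp
  rw [mul_pow, EuclideanSpace.real_norm_sq_eq, EuclideanSpace.real_norm_sq_eq,
    EuclideanSpace.real_norm_sq_eq, Fintype.sum_prod_type]
  simp only [Fin.sum_univ_two, hA]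
  nlinarith [sq_nonneg (z 0 * M (0, 1) - z 1 * M (0, 0)),
    sq_nonneg (z 0 * M (1, 1) - z 1 * M (1, 0))]

theorem continuous_fstV {Ω : Set Plane} :
    Continuous fun w : WithLp 2 (L2Vec Ω × L2Mat Ω) => w.fst :=
  (WithLp.fstL 2 ℝ (L2Vec Ω) (L2Mat Ω)).continuous

theorem continuous_sndV {Ω : Set Plane} :
    Continuous fun w : WithLp 2 (L2Vec Ω × L2Mat Ω) => w.snd :=
  (WithLp.sndL 2 ℝ (L2Vec Ω) (L2Mat Ω)).continuous

theorem eLpNorm_four_le_of_mem_smoothW12 {Ω ΓD : Set Plane} (hΩ : IsOpen Ω) {C : ℝ≥0}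
    (hC : ∀ φ : Plane → Plane, ContDiff ℝ 1 φ →
      eLpNorm φ 4 (volume.restrict Ω) ^ 4 ≤ C * (eLpNorm φ 2 (volume.restrict Ω) *
        (eLpNorm φ 2 (volume.restrict Ω) + eLpNorm (fderiv ℝ φ) 2 (volume.restrict Ω))) ^ 2)
    {w : WithLp 2 (L2Vec Ω × L2Mat Ω)} (hw : w ∈ smoothW12 Ω ΓD) :
    eLpNorm w.fst 4 (volume.restrict Ω) ^ 4
      ≤ C * (‖w.fst‖ₑ * (‖w.fst‖ₑ + ‖w.snd‖ₑ)) ^ 2 := by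
  obtain ⟨h1, φ, hφ, hu⟩ := hw
  have hu : w.fst =ᵐ[volume.restrict Ω] φ := hu
  have hG : ∀ᵐ x ∂(volume.restrict Ω), ∀ i j, w.snd x (i, j) = fderiv ℝ φ x (unitVec j) i :=
    ae_all_iff.2 fun i => ae_all_iff.2 fun j =>
      HasWeakGrad.ae_eq_fderiv hΩ (show HasWeakGrad Ω w.fst w.snd from h1) hφ.1 hu i j
  have hD : eLpNorm (fderiv ℝ φ) 2 (volume.restrict Ω) ≤ ‖w.snd‖ₑ := by
    rw [Lp.enorm_def]
    refine eLpNorm_mono_ae ?_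
    filter_upwards [hG] with x hx
    exact norm_le_of_forall_apply_eq hx
  rw [Lp.enorm_def w.fst, eLpNorm_congr_ae hu, eLpNorm_congr_ae hu]
  refine (hC φ (hφ.1.of_le (by simp))).trans ?_
  gcongr

/-- The Ladyzhenskaya inequality on `V_κ`. -/
theorem exists_eLpNorm_field_four_le {Ω ΓD : Set Plane} (hΩ : IsOpen Ω)
    (hb : Bornology.IsBounded Ω) (hl : HasLipschitzBoundary Ω) :
    ∃ C : ℝ≥0, ∀ v : Vκ Ω ΓD, eLpNorm (field v) 4 (volume.restrict Ω) ^ 4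
      ≤ C * (‖field v‖ₑ * (‖field v‖ₑ + ‖grad v‖ₑ)) ^ 2 := by
  obtain ⟨C, hC⟩ := exists_eLpNorm_four_le hΩ hb hl
  refine ⟨C, fun v => ?_⟩
  set μ := (volume : Measure Plane).restrict Ω
  obtain ⟨w, hw, hwv⟩ := mem_closure_iff_seq_limit.1
    (show v.1 ∈ closure (smoothW12 Ω ΓD : Set (WithLp 2 (L2Vec Ω × L2Mat Ω))) from v.2)
  have l1 : Tendsto (fun n => (w n).fst) atTop (𝓝 v.1.fst) :=
    (continuous_fstV.tendsto _).comp hwv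
  have l2 : Tendsto (fun n => (w n).snd) atTop (𝓝 v.1.snd) :=
    (continuous_sndV.tendsto _).comp hwv
  -- Approximating fields converge in `L²` only; an almost everywhere convergent subsequence lets
  -- Fatou's lemma carry over the `L⁴` bound.
  obtain ⟨ns, hns, hae⟩ := (tendstoInMeasure_of_tendsto_Lp l1).exists_seq_tendsto_ae
  have hlim : Tendsto (fun n => (C : ℝ≥0∞) * (‖(w (ns n)).fst‖ₑ *
      (‖(w (ns n)).fst‖ₑ + ‖(w (ns n)).snd‖ₑ)) ^ 2) atTop
      (𝓝 (C * (‖field v‖ₑ * (‖field v‖ₑ + ‖grad v‖ₑ)) ^ 2)) := by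
    have t1 := (l1.comp hns.tendsto_atTop).enorm
    have t2 := (l2.comp hns.tendsto_atTop).enorm
    have t3 : Tendsto (fun n => ‖(w (ns n)).fst‖ₑ * (‖(w (ns n)).fst‖ₑ + ‖(w (ns n)).snd‖ₑ)) atTop
        (𝓝 (‖field v‖ₑ * (‖field v‖ₑ + ‖grad v‖ₑ))) :=
      ENNReal.Tendsto.mul t1 (Or.inr (by finiteness)) (t1.add t2) (Or.inr (by finiteness))
    exact ENNReal.Tendsto.const_mul (ENNReal.Tendsto.pow (n := 2) t3) (Or.inr (by finiteness))
  have fatou : ∫⁻ x, ‖field v x‖ₑ ^ 4 ∂μ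
      ≤ liminf (fun n => ∫⁻ x, ‖(w (ns n)).fst x‖ₑ ^ 4 ∂μ) atTop := by
    refine le_trans (lintegral_mono_ae ?_) (lintegral_liminf_le' fun n =>
      (Lp.aestronglyMeasurable (w (ns n)).fst).enorm.pow_const 4)
    filter_upwards [hae] with x hx
    exact (ENNReal.Tendsto.pow (n := 4) hx.enorm).liminf_eq.ge
  rw [eLpNorm_four_pow, ← hlim.liminf_eq]
  refine fatou.trans (liminf_le_liminf (Eventually.of_forall fun n => ?_))
  rw [← eLpNorm_four_pow]
  exact eLpNorm_four_le_of_mem_smoothW12 hΩ hC (hw _)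

/-! ### The trilinear form -/

theorem norm_sq_eq {Ω ΓD : Set Plane} (v : Vκ Ω ΓD) :
    ‖v‖ ^ 2 = ‖toLκ v‖ ^ 2 + ‖grad v‖ ^ 2 :=
  WithLp.prod_norm_sq_eq_of_L2 v.1

/-- The norm of `L⁴(Ω)` on `V_κ`. -/
def normFour {Ω ΓD : Set Plane} (v : Vκ Ω ΓD) : ℝ :=
  (eLpNorm (field v) 4 (volume.restrict Ω)).toReal

/-- `C` is a constant for the Ladyzhenskaya inequality on `V_κ`. -/
def IsLadyzhenskayaConst (Ω ΓD : Set Plane) (C : ℝ) : Prop :=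
  0 ≤ C ∧ ∀ v : Vκ Ω ΓD, MemLp (field v) 4 (volume.restrict Ω) ∧
    normFour v ^ 2 ≤ C * ‖toLκ v‖ * ‖v‖

theorem exists_isLadyzhenskayaConst {Ω ΓD : Set Plane} (hΩ : IsOpen Ω)
    (hb : Bornology.IsBounded Ω) (hl : HasLipschitzBoundary Ω) :
    ∃ C, IsLadyzhenskayaConst Ω ΓD C := by
  obtain ⟨C, hC⟩ := exists_eLpNorm_field_four_le (ΓD := ΓD) hΩ hb hl
  -- The root comes from passing from fourth to second powers, the factor `2` from `‖toLκ v‖ + ‖grad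
  -- v‖ ≤ 2 * ‖v‖`.
  refine ⟨√C * 2, by positivity, fun v => ?_⟩
  have hv := hC v
  have hfin : (C : ℝ≥0∞) * (‖field v‖ₑ * (‖field v‖ₑ + ‖grad v‖ₑ)) ^ 2 ≠ ⊤ := by finiteness
  have h4 : eLpNorm (field v) 4 (volume.restrict Ω) ≠ ⊤ := by
    intro h
    rw [h] at hv
    exact hfin (top_le_iff.1 (by simpa using hv))
  refine ⟨⟨Lp.aestronglyMeasurable _, h4.lt_top⟩, ?_⟩
  have hr := ENNReal.toReal_mono hfin hv
  simp only [ENNReal.toReal_pow, ENNReal.toReal_mul, ENNReal.coe_toReal, toReal_enorm] at hr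
  rw [ENNReal.toReal_add (by finiteness) (by finiteness), toReal_enorm, toReal_enorm] at hr
  change normFour v ^ 4 ≤ C * (‖toLκ v‖ * (‖toLκ v‖ + ‖grad v‖)) ^ 2 at hr
  have hn := norm_sq_eq v
  have hsum : ‖toLκ v‖ + ‖grad v‖ ≤ 2 * ‖v‖ := by
    have h1 : ‖toLκ v‖ ≤ ‖v‖ := abs_le_of_sq_le_sq' (by nlinarith) (norm_nonneg _) |>.2
    have h2 : ‖grad v‖ ≤ ‖v‖ := abs_le_of_sq_le_sq' (by nlinarith) (norm_nonneg _) |>.2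
    linarith
  refine abs_le_of_sq_le_sq' ?_ (by positivity) |>.2
  calc (normFour v ^ 2) ^ 2 = normFour v ^ 4 := by ring
    _ ≤ C * (‖toLκ v‖ * (‖toLκ v‖ + ‖grad v‖)) ^ 2 := hr
    _ ≤ C * (‖toLκ v‖ * (2 * ‖v‖)) ^ 2 := by gcongr
    _ = √C ^ 2 * (‖toLκ v‖ * (2 * ‖v‖)) ^ 2 := by rw [Real.sq_sqrt C.coe_nonneg]
    _ = _ := by ring

theorem abs_sum_mul_mul_le (a c : Plane) (M : Mat) :
    |∑ i : Fin 2, ∑ j : Fin 2, a j * M (i, j) * c i| ≤ ‖a‖ * ‖M‖ * ‖c‖ := by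
  refine abs_le_of_sq_le_sq ?_ (by positivity)
  rw [mul_pow, mul_pow, EuclideanSpace.real_norm_sq_eq, EuclideanSpace.real_norm_sq_eq,
    EuclideanSpace.real_norm_sq_eq]
  have e : ∑ i : Fin 2, ∑ j : Fin 2, a j * M (i, j) * c i
      = ∑ p : Fin 2 × Fin 2, M p * (a p.2 * c p.1) := by
    rw [Fintype.sum_prod_type]
    exact Finset.sum_congr rfl fun i _ => Finset.sum_congr rfl fun j _ => by ring
  rw [e]
  refine (Finset.sum_mul_sq_le_sq_mul_sq _ _ _).trans (le_of_eq ?_)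
  simp only [Fintype.sum_prod_type, Fin.sum_univ_two]
  ring

/-- Hölder's inequality with exponents `4, 2, 4`. The integrability is recorded because splitting
the integral in `trilinear_sub` requires it. -/
theorem trilinear_bound {Ω ΓD : Set Plane} {C : ℝ} (hC : IsLadyzhenskayaConst Ω ΓD C)
    (θ ψ φ : Vκ Ω ΓD) :
    Integrable (fun x => ∑ i : Fin 2, ∑ j : Fin 2, field θ x j * grad ψ x (i, j) * field φ x i)
      (volume.restrict Ω) ∧
    |trilinear θ ψ φ| ≤ normFour θ * ‖grad ψ‖ * normFour φ := by
  set μ := (volume : Measure Plane).restrict Ω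
  have hθ := (hC.2 θ).1.norm
  have hφ := (hC.2 φ).1.norm
  have hψ := (Lp.memLp (grad ψ)).norm
  have : ENNReal.HolderTriple 4 4 2 := ⟨by
    rw [← ENNReal.toReal_eq_toReal_iff' (by finiteness) (by finiteness)]
    rw [ENNReal.toReal_add (by finiteness) (by finiteness)]
    norm_num⟩
  have hθφ : MemLp ((fun x => ‖field θ x‖) • fun x => ‖field φ x‖) 2 μ := hφ.smul hθ
  have hall : MemLp ((fun x => ‖grad ψ x‖) • ((fun x => ‖field θ x‖) • fun x => ‖field φ x‖)) 1 μ :=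
    hθφ.smul hψ
  have hpt : ∀ x, ‖∑ i : Fin 2, ∑ j : Fin 2, field θ x j * grad ψ x (i, j) * field φ x i‖
      ≤ ((fun x => ‖grad ψ x‖) • ((fun x => ‖field θ x‖) • fun x => ‖field φ x‖)) x := by
    intro x
    refine (abs_sum_mul_mul_le _ _ _).trans (le_of_eq ?_)
    simp only [Pi.smul_apply', smul_eq_mul, Pi.mul_apply]; ring
  have hθm : ∀ j, AEStronglyMeasurable (fun x => field θ x j) μ := fun j =>
    (EuclideanSpace.proj (𝕜 := ℝ) j).continuous.comp_aestronglyMeasurable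
      (Lp.aestronglyMeasurable (field θ))
  have hφm : ∀ j, AEStronglyMeasurable (fun x => field φ x j) μ := fun j =>
    (EuclideanSpace.proj (𝕜 := ℝ) j).continuous.comp_aestronglyMeasurable
      (Lp.aestronglyMeasurable (field φ))
  have hψm : ∀ i j, AEStronglyMeasurable (fun x => grad ψ x (i, j)) μ := fun i j =>
    (EuclideanSpace.proj (𝕜 := ℝ) (i, j)).continuous.comp_aestronglyMeasurable
      (Lp.aestronglyMeasurable (grad ψ))
  have hm : AEStronglyMeasurable
      (fun x => ∑ i : Fin 2, ∑ j : Fin 2, field θ x j * grad ψ x (i, j) * field φ x i) μ := by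
    refine Finset.aestronglyMeasurable_fun_sum _ fun i _ =>
      Finset.aestronglyMeasurable_fun_sum _ fun j _ => ?_
    exact ((hθm j).mul (hψm i j)).mul (hφm i)
  refine ⟨(memLp_one_iff_integrable.1 hall).mono' hm (Eventually.of_forall hpt), ?_⟩
  have b1 := eLpNorm_smul_le_mul_eLpNorm (p := 2) (q := 2) (r := 1) hθφ.1 hψ.1
  have b2 := eLpNorm_smul_le_mul_eLpNorm (p := 4) (q := 4) (r := 2) hφ.1 hθ.1
  simp only [eLpNorm_norm] at b1 b2
  have b3 : ‖trilinear θ ψ φ‖ₑ ≤ eLpNorm (grad ψ) 2 μ *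
      (eLpNorm (field θ) 4 μ * eLpNorm (field φ) 4 μ) := by
    refine (enorm_integral_le_lintegral_enorm _).trans ?_
    refine le_trans ?_ (b1.trans (mul_le_mul_right b2 _))
    rw [eLpNorm_one_eq_lintegral_enorm]
    refine lintegral_mono fun x => ?_
    exact enorm_le_iff_norm_le.2 ((hpt x).trans (le_abs_self _))
  have b4 := ENNReal.toReal_mono (ENNReal.mul_ne_top (Lp.eLpNorm_ne_top (grad ψ))
    (ENNReal.mul_ne_top (hC.2 θ).1.2.ne (hC.2 φ).1.2.ne)) b3
  rw [toReal_enorm, ENNReal.toReal_mul, ENNReal.toReal_mul] at b4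
  refine b4.trans (le_of_eq ?_)
  rw [Lp.norm_def (grad ψ)]
  simp only [normFour]
  ring

theorem field_sub_ae {Ω ΓD : Set Plane} (v w : Vκ Ω ΓD) :
    ∀ᵐ x ∂(volume.restrict Ω), field (v - w) x = field v x - field w x :=
  Lp.coeFn_sub (field v) (field w)

theorem grad_sub_ae {Ω ΓD : Set Plane} (v w : Vκ Ω ΓD) :
    ∀ᵐ x ∂(volume.restrict Ω), grad (v - w) x = grad v x - grad w x :=
  Lp.coeFn_sub (grad v) (grad w)

theorem trilinear_sub {Ω ΓD : Set Plane} {C : ℝ} (hC : IsLadyzhenskayaConst Ω ΓD C)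
    (u v φ : Vκ Ω ΓD) :
    trilinear u u φ - trilinear v v φ = trilinear (u - v) u φ + trilinear v (u - v) φ := by
  unfold trilinear
  rw [← integral_sub (trilinear_bound hC u u φ).1 (trilinear_bound hC v v φ).1,
    ← integral_add (trilinear_bound hC (u - v) u φ).1 (trilinear_bound hC v (u - v) φ).1]
  refine integral_congr_ae ?_
  filter_upwards [field_sub_ae u v, grad_sub_ae u v] with x h1 h2
  simp only [h1, h2, Fin.sum_univ_two, PiLp.sub_apply]
  ring

/-! ### Energy estimate for the difference of two fields -/

/-- A primitive with values in a Hilbert space that satisfies a linear energy inequality with an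
integrable coefficient vanishes. -/
theorem integral_eq_zero_of_two_inner_le {H : Type*} [NormedAddCommGroup H] [InnerProductSpace ℝ H]
    [CompleteSpace H] {g : ℝ → H} {a : ℝ → ℝ} {T : ℝ} (hT : 0 < T) (hg : IntegrableOn g (Ioo 0 T))
    (ha : IntegrableOn a (Ioo 0 T)) (ha0 : ∀ t, 0 ≤ a t)
    (h : ∀ᵐ t ∂(volume.restrict (Ioo (0 : ℝ) T)),
      2 * inner ℝ (g t) (∫ s in (0 : ℝ)..t, g s) ≤ a t * ‖∫ s in (0 : ℝ)..t, g s‖ ^ 2) :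
    ∀ t ∈ Icc 0 T, ∫ s in (0 : ℝ)..t, g s = 0 := by
  obtain ⟨hWi, hWe⟩ := norm_sq_integral_eq hT.le hg
  have hWc : ContinuousOn (fun t => ∫ s in (0 : ℝ)..t, g s) (uIcc 0 T) :=
    (absolutelyContinuousOnInterval_integral
      (intervalIntegrable_of_integrableOn_Ioo hT.le hg)).continuousOn
  have hy : ContinuousOn (fun t => ‖∫ s in (0 : ℝ)..t, g s‖ ^ 2) (uIcc 0 T) := hWc.norm.pow 2
  have hay := (intervalIntegrable_of_integrableOn_Ioo hT.le ha).mul_continuousOn hy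
  rw [uIcc_of_le hT.le] at hy
  have hzero := eq_zero_of_le_integral_mul hT hy (fun t _ => sq_nonneg _) ha ha0 (by
    intro t ht
    have hsub : uIcc 0 t ⊆ uIcc 0 T := by
      rw [uIcc_of_le hT.le, uIcc_of_le ht.1]; exact Icc_subset_Icc_right ht.2
    rw [hWe t ht, ← intervalIntegral.integral_const_mul]
    refine intervalIntegral.integral_mono_ae_restrict ht.1 ((hWi.const_mul 2).mono_set hsub)
      (hay.mono_set hsub) ?_
    rw [← restrict_Ioo_eq_restrict_Icc]
    exact ae_restrict_of_ae_restrict_of_subset (Ioo_subset_Ioo_right ht.2) h)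
  exact fun t ht => by simpa using hzero t ht

/-- The scalar core of the energy estimate, for `w = u - v`: `m`, `n`, `k`, `q` stand for
`‖w‖_{L²}`, `‖w‖_{W^{1,2}}`, `‖∇w‖`, `‖w‖₄`; `A` and `G` for `‖u‖_{W^{1,2}}` and `‖∇u‖`; `B` and `p`
for `‖v‖_{W^{1,2}}` and `‖v‖₄`; `M` bounds `‖v‖_{L²}`. Three uses of Young's inequality cost `n ^ 2
/ 4` each, leaving one quarter. The `1` in the coefficient is the price of replacing `k ^ 2` by `n ^
2 - m ^ 2`. -/
theorem young_estimate {C M m n A B G k p q I b₁ b₂ : ℝ} (hC : 0 ≤ C) (hM : 0 ≤ M) (hm : 0 ≤ m)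
    (hn : 0 ≤ n) (hB : 0 ≤ B) (hG : 0 ≤ G) (hGA : G ≤ A)
    (hk : n ^ 2 = m ^ 2 + k ^ 2) (hp : 0 ≤ p) (hq : 0 ≤ q)
    (hq2 : q ^ 2 ≤ C * m * n) (hp2 : p ^ 2 ≤ C * M * B) (h : I + k ^ 2 + (b₁ + b₂) = 0)
    (h₁ : -(q * G * q) ≤ b₁) (h₂ : -(p * k * q) ≤ b₂) :
    I + n ^ 2 / 4 ≤ (1 + C ^ 2 * A ^ 2 + C ^ 4 * M ^ 2 * B ^ 2) * m ^ 2 := by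
  have hkn : k ≤ n := (abs_le_of_sq_le_sq' (by linarith [sq_nonneg m]) hn).2
  have e1 : q * G * q ≤ n ^ 2 / 4 + C ^ 2 * A ^ 2 * m ^ 2 := by
    calc q * G * q = q ^ 2 * G := by ring
      _ ≤ (C * m * n) * A := mul_le_mul hq2 hGA hG (by positivity)
      _ ≤ _ := by linarith [sq_nonneg (n / 2 - C * A * m)]
  have e2 : p * k * q ≤ n ^ 2 / 4 + p ^ 2 * q ^ 2 := by
    calc p * k * q ≤ p * n * q := by gcongr
      _ ≤ _ := by linarith [sq_nonneg (n / 2 - p * q)]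
  have e3 : p ^ 2 * q ^ 2 ≤ n ^ 2 / 4 + C ^ 4 * M ^ 2 * B ^ 2 * m ^ 2 := by
    calc p ^ 2 * q ^ 2 ≤ (C * M * B) * (C * m * n) :=
          mul_le_mul hp2 hq2 (by positivity) (by positivity)
      _ ≤ _ := by linarith [sq_nonneg (n / 2 - C ^ 2 * M * B * m)]
  linarith

/-- The energy estimate for the difference of two velocity fields at a fixed time. -/
theorem inner_add_le_of_eq_zero {Ω ΓD : Set Plane} {C M : ℝ} (hC : IsLadyzhenskayaConst Ω ΓD C)
    {u v : Vκ Ω ΓD} {h : Lκ Ω ΓD} (hv : ‖toLκ v‖ ≤ M)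
    (heq : inner ℝ h (toLκ (u - v)) + energy (u - v) (u - v)
      + (trilinear u u (u - v) - trilinear v v (u - v)) = 0) :
    inner ℝ h (toLκ (u - v)) + ‖u - v‖ ^ 2 / 4
      ≤ (1 + C ^ 2 * ‖u‖ ^ 2 + C ^ 4 * M ^ 2 * ‖v‖ ^ 2) * ‖toLκ (u - v)‖ ^ 2 := by
  rw [trilinear_sub hC] at heq
  have t1 := (abs_le.1 (trilinear_bound hC (u - v) u (u - v)).2).1
  have t2 := (abs_le.1 (trilinear_bound hC v (u - v) (u - v)).2).1
  have hq := (hC.2 (u - v)).2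
  have hp := (hC.2 v).2
  have hw := norm_sq_eq (u - v)
  have hu := norm_sq_eq u
  have he : energy (u - v) (u - v) = ‖grad (u - v)‖ ^ 2 := real_inner_self_eq_norm_sq _
  rw [he] at heq
  refine young_estimate hC.1 ((norm_nonneg _).trans hv) (norm_nonneg _) (norm_nonneg _)
    (norm_nonneg _) (norm_nonneg (grad u)) (abs_le_of_sq_le_sq' ?_ (norm_nonneg _)).2
    hw ENNReal.toReal_nonneg ENNReal.toReal_nonneg hq (hp.trans ?_) heq t1 t2
  · rw [hu]; exact le_add_of_nonneg_left (sq_nonneg _)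
  · exact mul_le_mul_of_nonneg_right (mul_le_mul_of_nonneg_left hv hC.1) (norm_nonneg _)

/-! ### Uniqueness for the evolution problem -/

section Evolution

variable {Ω ΓD : Set Plane} {T : ℝ}

theorem integrableOn_timeL2 {E : Type} [NormedAddCommGroup E] (u : TimeL2 T E) :
    IntegrableOn u (Ioo 0 T) :=
  (Lp.memLp u).integrable (by norm_num)

/-- An element of `X` is the primitive of its derivative. -/
theorem ae_toLκ_eq (hT : 0 < T) (u : X Ω ΓD T) :
    ∀ᵐ t ∂(volume.restrict (Ioo (0 : ℝ) T)),
      toLκ (u.1 t) = initialValue u + ∫ s in (0 : ℝ)..t, timeDeriv u s := by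
  have hg := integrableOn_timeL2 (timeDeriv u)
  have hu : IntegrableOn (fun t => toLκ (u.1 t)) (Ioo 0 T) :=
    ((toLκ (Ω := Ω) (ΓD := ΓD)).comp_memLp' (Lp.memLp u.1)).integrable (by norm_num)
  obtain ⟨c, hc⟩ := IsTimeDeriv.exists_eq_add_integral hT u.2.2.choose_spec hu hg
  have hcont : ContinuousOn (fun t => c + ∫ s in (0 : ℝ)..t, timeDeriv u s) (Icc 0 T) := by
    have := (absolutelyContinuousOnInterval_integral
      (intervalIntegrable_of_integrableOn_Ioo hT.le hg)).continuousOn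
    rw [uIcc_of_le hT.le] at this
    exact continuousOn_const.add this
  have hex : ∃ c : ℝ → Lκ Ω ΓD, ContinuousOn c (Icc 0 T) ∧
      (fun t => toLκ (u.1 t)) =ᵐ[volume.restrict (Ioo (0 : ℝ) T)] c := ⟨_, hcont, hc⟩
  have hinit : initialValue u = c := by
    rw [initialValue, dif_pos hex]
    obtain ⟨h1, h2⟩ := hex.choose_spec
    -- Continuous representatives that agree almost everywhere agree on the closed interval, hence
    -- at `0`, so the chosen one has the right initial value.
    have hae : hex.choose =ᵐ[volume.restrict (Icc 0 T)]
        fun t => c + ∫ s in (0 : ℝ)..t, timeDeriv u s := by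
      rw [← restrict_Ioo_eq_restrict_Icc]
      exact h2.symm.trans hc
    have := Measure.eqOn_Icc_of_ae_eq volume hT.ne hae h1 hcont ⟨le_rfl, hT.le⟩
    simpa using this
  rw [hinit]
  exact hc

theorem ae_functional_eq {u₁ u₂ : X Ω ΓD T} (h : 𝒩 u₁ = 𝒩 u₂) :
    ∀ᵐ t ∂(volume.restrict (Ioo (0 : ℝ) T)), ∀ v : Vκ Ω ΓD,
      inner ℝ (timeDeriv u₁ t - timeDeriv u₂ t) (toLκ v) + energy (u₁.1 t - u₂.1 t) v
        + (trilinear (u₁.1 t) (u₁.1 t) v - trilinear (u₂.1 t) (u₂.1 t) v) = 0 := by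
  have h1 := Germ.coe_eq.1 (congrArg Prod.fst h)
  filter_upwards [h1] with t ht v
  have := congrFun ht v
  have he : energy (u₁.1 t - u₂.1 t) v = energy (u₁.1 t) v - energy (u₂.1 t) v :=
    inner_sub_left (𝕜 := ℝ) (grad (u₁.1 t)) (grad (u₂.1 t)) (grad v)
  rw [he, inner_sub_left]
  linarith

set_option maxHeartbeats 1000000 in
/-- The Navier–Stokes operator is injective on `X`. -/
theorem 𝒩_injective (hΩ : IsOpen Ω) (hb : Bornology.IsBounded Ω) (hl : HasLipschitzBoundary Ω)
    (hT : 0 < T) : Function.Injective (𝒩 : X Ω ΓD T → FunctionalData Ω ΓD T) := by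
  intro u₁ u₂ h
  obtain ⟨C, hC⟩ := exists_isLadyzhenskayaConst (ΓD := ΓD) hΩ hb hl
  have hinit : initialValue u₁ = initialValue u₂ := congrArg Prod.snd h
  have i1 := integrableOn_timeL2 (timeDeriv u₁)
  have i2 := integrableOn_timeL2 (timeDeriv u₂)
  have ii1 := intervalIntegrable_of_integrableOn_Ioo hT.le i1
  have ii2 := intervalIntegrable_of_integrableOn_Ioo hT.le i2
  obtain ⟨M₀, hM₀⟩ := (absolutelyContinuousOnInterval_integral ii2).exists_bound
  rw [uIcc_of_le hT.le] at hM₀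
  -- A bound for `u₂` in `L²`, uniform in time; it leaves only `‖u₂‖ ^ 2` in the coefficient `a`,
  -- which is integrable.
  set M := ‖initialValue u₂‖ + M₀
  set g : ℝ → Lκ Ω ΓD := fun t => timeDeriv u₁ t - timeDeriv u₂ t with hg
  have ig : IntegrableOn g (Ioo 0 T) := i1.sub i2
  set W : ℝ → Lκ Ω ΓD := fun t => ∫ s in (0 : ℝ)..t, g s with hW
  have hWae : ∀ᵐ t ∂(volume.restrict (Ioo (0 : ℝ) T)), toLκ (u₁.1 t - u₂.1 t) = W t := by
    filter_upwards [ae_toLκ_eq hT u₁, ae_toLκ_eq hT u₂, ae_restrict_mem measurableSet_Ioo]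
      with t h1 h2 ht
    have hsub : uIcc 0 t ⊆ uIcc 0 T := by
      rw [uIcc_of_le hT.le, uIcc_of_le ht.1.le]; exact Icc_subset_Icc_right ht.2.le
    rw [map_sub, h1, h2, hinit, add_sub_add_left_eq_sub, hW,
      ← intervalIntegral.integral_sub (ii1.mono_set hsub) (ii2.mono_set hsub)]
  set a : ℝ → ℝ := fun t => 2 * (1 + C ^ 2 * ‖u₁.1 t‖ ^ 2 + C ^ 4 * M ^ 2 * ‖u₂.1 t‖ ^ 2) with ha
  have ha0 : ∀ t, 0 ≤ a t := fun t => by positivity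
  have hai : IntegrableOn a (Ioo 0 T) := by
    have j1 : IntegrableOn (fun t => ‖u₁.1 t‖ ^ 2) (Ioo 0 T) :=
      (Lp.memLp u₁.1).integrable_norm_pow (by norm_num)
    have j2 : IntegrableOn (fun t => ‖u₂.1 t‖ ^ 2) (Ioo 0 T) :=
      (Lp.memLp u₂.1).integrable_norm_pow (by norm_num)
    have j0 : IntegrableOn (fun _ : ℝ => (1 : ℝ)) (Ioo 0 T) := integrableOn_const (by simp)
    exact ((j0.add (j1.const_mul _)).add (j2.const_mul _)).const_mul 2
  have hest : ∀ᵐ t ∂(volume.restrict (Ioo (0 : ℝ) T)),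
      2 * inner ℝ (g t) (W t) + ‖u₁.1 t - u₂.1 t‖ ^ 2 / 2 ≤ a t * ‖W t‖ ^ 2 := by
    filter_upwards [ae_functional_eq h, hWae, ae_toLκ_eq hT u₂, ae_restrict_mem measurableSet_Ioo]
      with t h1 h2 h3 ht
    have hv : ‖toLκ (u₂.1 t)‖ ≤ M := by
      rw [h3]
      exact (norm_add_le _ _).trans (add_le_add le_rfl (hM₀ t (Ioo_subset_Icc_self ht)))
    -- The exceptional null set does not depend on the test field, so testing with the
    -- time-dependent `u₁ t - u₂ t` is allowed.
    have := inner_add_le_of_eq_zero hC hv (h1 _)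
    rw [h2] at this
    simp only [ha, hg]
    linarith
  have hzero := integral_eq_zero_of_two_inner_le hT ig hai ha0 (by
    filter_upwards [hest] with t ht
    linarith [sq_nonneg ‖u₁.1 t - u₂.1 t‖])
  refine Subtype.ext (Lp.ext ?_)
  -- With `W = 0` the estimate reduces to its leftover term, the squared norm in `V_κ`.
  filter_upwards [hest, ae_restrict_mem measurableSet_Ioo] with t h1 ht
  have hWt : W t = 0 := hzero t (Ioo_subset_Icc_self ht)
  rw [hWt] at h1
  simp only [inner_zero_right, norm_zero] at h1
  have h2 : ‖u₁.1 t - u₂.1 t‖ ^ 2 ≤ 0 := by linarith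
  exact sub_eq_zero.1 (norm_eq_zero.1 (pow_eq_zero_iff two_ne_zero |>.1
    (le_antisymm h2 (sq_nonneg _))))

end Evolution

end MixedNS

end

theorem mainTheorem8 (Ω ΓD ΓN : Set MixedNS.Plane) (hΩ : MixedNS.IsMixedDomain Ω ΓD ΓN)
    (T : ℝ) (hT : 0 < T) :
    (∀ u₁ u₂ : MixedNS.X Ω ΓD T, MixedNS.𝒩 u₁ = MixedNS.𝒩 u₂ → u₁ = u₂) ∧
    (∀ (f : MixedNS.TimeL2 T (MixedNS.Lκ Ω ΓD)) (u₀ : MixedNS.Vκ Ω ΓD)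
      (u₁ u₂ : MixedNS.X Ω ΓD T),
      MixedNS.IsGeneralizedSolution u₁ f u₀ → MixedNS.IsGeneralizedSolution u₂ f u₀ →
        u₁ = u₂) := by
  have hinj := MixedNS.𝒩_injective (ΓD := ΓD) hΩ.isOpen hΩ.isBounded hΩ.lipschitz hT
  refine ⟨fun u₁ u₂ h => hinj h, fun f u₀ u₁ u₂ h₁ h₂ => hinj ?_⟩
  rw [(MixedNS.isGeneralizedSolution_iff u₁ f u₀).1 h₁,
    (MixedNS.isGeneralizedSolution_iff u₂ f u₀).1 h₂]
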